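/- A robust factored MDP (RFMDP) $\mathcal R$ with $N\ge 1$ sub-states consists of finite sub-state spaces $\mathcal S_1,\dots,\mathcal S_N$ with $\mathcal S=\prod_{n}\mathcal S_n$, a finite non-empty action space $\mathcal A$, a feature map $\phi$ on $\mathcal S\times\mathcal A$ with values in a set $\Phi$, initial distributions $q_n\in\Delta(\mathcal S_n)$, marginal ambiguity sets $\mathcal P^n(\varphi)\subseteq\Delta(\mathcal S_n)$, $\varphi\in\Phi$, that are polyhedra and are non-empty for all $\varphi=\phi(s,a)$, rewards $r(\phi(s,a))\in\mathbb R$, and a discount factor $\gamma\in(0,1)$. (Binary instances have $\mathcal S_n=\{0,1\}$, $\mathcal A\subseteq\{0,1\}^k$ and $\Phi=\{0,1\}^F$.) For a policy $\pi:\mathcal S\to\mathcal A$ and a kernel $p:\Phi\to\Delta(\mathcal S)$, let $\mathbb E_p^\pi\big[\sum_{t\ge0}\gamma^t\, r(\phi(\tilde s^t,\pi(\tilde s^t)))\big]$ be the expected total reward of the Markov chain with initial distribution $\prod_n q_n$ and transition probabilities $p(\cdot\,|\,\phi(s,\pi(s)))$. Let $\mathcal P^{\mathrm{NF}}$ be the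 set of all kernels $p$ such that for all $(s,a)\in\mathcal S\times\mathcal A$ and all $n$ the $n$-th marginal of $p(\cdot|\phi(s,a))$ lies in $\mathcal P^n(\phi(s,a))$, and $\mathcal P^{\mathrm F}$ the set of all kernels $p$ such that for all $(s,a)\in\mathcal S\times\mathcal A$ the distribution $p(\cdot|\phi(s,a))$ is a product $\prod_n p_n$ with $p_n\in\mathcal P^n(\phi(s,a))$. Let $\mathrm{NF}(\pi;\mathcal R)$ and $\mathrm F(\pi;\mathcal R)$ be the infima of the expected total reward over $p\in\mathcal P^{\mathrm{NF}}$ and $p\in\mathcal P^{\mathrm F}$, and let $\mathrm{NF}^\star(\mathcal R)$, $\mathrm F^\star(\mathcal R)$ be their suprema over $\pi$. Fix $s^0\in\mathcal S$ and $a^0\in\mathcal A$. The lift of $\mathcal R$ is the RFMDP with states $\hat s=(u,m,a,n)\in\mathcal S\times\mathcal S\times\mathcal A\times[N]$, whose $2N+2$ sub-states are the components of $u$ and $m$ as well as $a$ and $n$, with action space $\mathcal A$, discount factor $\gamma^{1/N}$, and an initial state $(u,s^0,a^0,1)$ with $u\sim\prod_n q_n$. Its feature map sends $(\hat s,\hat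 a)$ to $(\hat s,\hat a,\phi(u,\hat a),\phi(m,a))$, so its kernels may depend on the full lifted state and action. When action $\hat a$ is taken in state $(u,m,a,n)$, the reward is $r(\phi(u,\hat a))$ if $(m,a,n)=(s^0,a^0,1)$ and $0$ otherwise, and the marginal ambiguity sets prescribe that $u'_n$ follows some distribution in $\mathcal P^n(\phi(u,\hat a))$ if $n=1$ and in $\mathcal P^n(\phi(m,a))$ if $n>1$, while deterministically $u'_\eta=u_\eta$ for $\eta\neq n$, $n'=n+1$ for $n<N$ and $n'=1$ for $n=N$, and $(m',a')=(s^0,a^0)$ if $n=N$, $(m',a')=(u,\hat a)$ if $n=1<N$, and $(m',a')=(m,a)$ otherwise. For $\hat\pi:\hat{\mathcal S}\to\mathcal A$ let $\mathrm L(\hat\pi;\mathcal R)$ be the non-factored objective of the lift, $\mathrm L^\star(\mathcal R)=\sup_{\hat\pi}\mathrm L(\hat\pi;\mathcal R)$, and for a policy $\pi$ of $\mathcal R$ let $\hat\Pi(\pi)$ be the set of all $\hat\pi$ with $\hat\pi(u,s^0,a^0,1)=\pi(u)$ for all $u\in\mathcal S$. Theorem. (i) For every RFMDP $\mathcal R$,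 all $s^0$, $a^0$, every policy $\pi$ and every $\hat\pi\in\hat\Pi(\pi)$, $\mathrm{NF}(\pi;\mathcal R)\le\mathrm L(\hat\pi;\mathcal R)\le\mathrm F(\pi;\mathcal R)$. Moreover, each of the four patterns $\mathrm{NF}<\mathrm L<\mathrm F$, $\mathrm{NF}=\mathrm L<\mathrm F$, $\mathrm{NF}<\mathrm L=\mathrm F$ and $\mathrm{NF}=\mathrm L=\mathrm F$ occurs for some binary instance $\mathcal R$ and some policy $\pi$, for all $s^0$, $a^0$ and all $\hat\pi\in\hat\Pi(\pi)$. (ii) For every $N\ge1$ and $\gamma\in(0,1)$ there is a binary RFMDP $\mathcal R$ with $N$ sub-states, discount factor $\gamma$ and rewards in $\{0,1\}$ such that $\mathrm{NF}^\star(\mathcal R)=\mathrm L^\star(\mathcal R)=0$ (for all $s^0$, $a^0$) while $\mathrm F^\star(\mathcal R)=\gamma(1-\gamma)^{-1}\big(1-2^{-\lfloor N/2\rfloor}\big)$. (iii) For every $N\ge1$ and $\gamma\in(0,1)$ there is a binary RFMDP $\mathcal R$ with $N$ sub-states, discount factor $\gamma$ and rewards in $\{0,1\}$ such that $\mathrm{NF}^\star(\mathcal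 R)=0$ while $\mathrm L^\star(\mathcal R)=\mathrm F^\star(\mathcal R)=\gamma(1-\gamma)^{-1}\big(1-2^{-(N-1)}\big)$ (for all $s^0$, $a^0$). -/

import Mathlib

open MeasureTheory ProbabilityTheory

noncomputable section

/-! ### Discounted rewards of finite Markov chains

`stdSimplex ℝ X` is the set `Δ(X)` of probability distributions on the finite set `X`. -/

/-- The distribution `p ∈ Δ(X)`, viewed as a measure on `X`. -/
def simplexMeasure {X : Type} [Fintype X] [MeasurableSpace X] (p : stdSimplex ℝ X) : Measure X :=
  ∑ x, ENNReal.ofReal (p x) • Measure.dirac x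

instance simplexMeasure_isProbabilityMeasure {X : Type} [Fintype X] [MeasurableSpace X]
    (p : stdSimplex ℝ X) : IsProbabilityMeasure (simplexMeasure p) := by
  constructor
  have h : ∑ x, ENNReal.ofReal (p x) = 1 := by
    change ∑ x, ENNReal.ofReal (p.1 x) = 1
    rw [← ENNReal.ofReal_sum_of_nonneg (fun x _ => p.2.1 x), p.2.2, ENNReal.ofReal_one]
  simp [simplexMeasure, h]

/-- The one-step transition kernel of the Markov chain with transition probabilities `K x`. -/
def stepKernel {X : Type} [Fintype X] [MeasurableSpace X] [DiscreteMeasurableSpace X]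
    (K : X → stdSimplex ℝ X) : Kernel X X :=
  Kernel.ofFunOfCountable fun x => simplexMeasure (K x)

instance stepKernel_isMarkovKernel {X : Type} [Fintype X] [MeasurableSpace X]
    [DiscreteMeasurableSpace X] (K : X → stdSimplex ℝ X) : IsMarkovKernel (stepKernel K) :=
  ⟨fun x => simplexMeasure_isProbabilityMeasure (K x)⟩

/-- The law, on the space of trajectories `ℕ → X`, of the time-homogeneous Markov chain with
initial distribution `q` and transition probabilities `K`. -/
def chainLaw {X : Type} [Fintype X] [MeasurableSpace X] [DiscreteMeasurableSpace X]
    (q : stdSimplex ℝ X) (K : X → stdSimplex ℝ X) : Measure (ℕ → X) :=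
  Kernel.trajMeasure (X := fun _ => X) (simplexMeasure q) fun t =>
    (stepKernel K).comap (fun ω : (i : Finset.Iic t) → X => ω ⟨t, Finset.mem_Iic.2 le_rfl⟩)
      (measurable_pi_apply _)

/-- `𝔼 [∑ₜ γᵗ c(s̃ᵗ) | s̃⁰ ∼ q]` for the Markov chain with transition probabilities `K`. -/
def expectedTotalReward {X : Type} [Fintype X] (q : stdSimplex ℝ X) (K : X → stdSimplex ℝ X)
    (c : X → ℝ) (γ : ℝ) : ℝ :=
  letI : MeasurableSpace X := ⊤
  ∫ ω, ∑' t : ℕ, γ ^ t * c (ω t) ∂(chainLaw q K)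

/-! ### Product distributions, marginals, polyhedra -/

/-- The product distribution `s ↦ ∏ₙ qₙ(sₙ)`. -/
def productDistribution {ι : Type} [Fintype ι] [DecidableEq ι] {S : ι → Type}
    [∀ i, Fintype (S i)] (q : ∀ i, stdSimplex ℝ (S i)) : stdSimplex ℝ (∀ i, S i) :=
  ⟨fun s => ∏ i, q i (s i), fun _ => Finset.prod_nonneg fun i _ => (q i).2.1 _, by
    rw [← Fintype.prod_sum]
    exact Finset.prod_eq_one fun i _ => (q i).2.2⟩

open Classical in
/-- The marginal distribution of the `i`-th component of `p`. -/
def marg {ι : Type} [Fintype ι] [DecidableEq ι] {S : ι → Type} [∀ i, Fintype (S i)]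
    (p : stdSimplex ℝ (∀ i, S i)) (i : ι) : S i → ℝ :=
  fun σ => ∑ s, if s i = σ then p s else 0

/-- A polyhedron: the solution set of a finite system of linear inequalities `G x ≤ h`. -/
def IsPolyhedron {X : Type} [Fintype X] (C : Set (X → ℝ)) : Prop :=
  ∃ (m : ℕ) (G : Matrix (Fin m) X ℝ) (h : Fin m → ℝ), C = {x | G.mulVec x ≤ h}

theorem isPolyhedron_singleton {X : Type} [Fintype X] (y : X → ℝ) : IsPolyhedron {y} := by
  classical
  let e := Fintype.equivFin (X ⊕ X)
  refine ⟨Fintype.card (X ⊕ X),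
    fun k x => Sum.elim (fun z => if z = x then 1 else 0) (fun z => if z = x then -1 else 0)
      (e.symm k),
    fun k => Sum.elim (fun z => y z) (fun z => -y z) (e.symm k), ?_⟩
  ext x
  simp only [Set.mem_singleton_iff, Set.mem_ofPred_eq, Pi.le_def, Matrix.mulVec, dotProduct]
  rw [← e.forall_congr_right]
  simp only [Equiv.symm_apply_apply, Sum.forall, Sum.elim_inl, Sum.elim_inr, ite_mul, one_mul,
    neg_mul, zero_mul, Finset.sum_ite_eq, Finset.mem_univ, if_true, neg_le_neg_iff]
  rw [funext_iff]
  exact ⟨fun h => ⟨fun z => (h z).le, fun z => (h z).ge⟩,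
    fun h z => le_antisymm (h.1 z) (h.2 z)⟩

/-! ### Robust factored MDPs -/

/-- A robust (feature-based) factored MDP `(𝒮, 𝒜, φ, q, 𝒫, r, γ)` with finite sub-state spaces
`S i`, state space `∀ i, S i`, action space `A` and feature space `Φ`. The ambiguity set is
described by the marginal ambiguity sets `P i f ⊆ Δ(S i)`; `r` is the total one-step reward
(the sum of all reward components). -/
structure RFMDP {ι : Type} (S : ι → Type) [∀ i, Fintype (S i)] (A Φ : Type) where
  /-- the feature map -/
  φ : (∀ i, S i) → A → Φ
  /-- the initial distributions of the sub-states -/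
  q : ∀ i, stdSimplex ℝ (S i)
  /-- the marginal ambiguity sets -/
  P : ∀ i, Φ → Set (S i → ℝ)
  P_subset : ∀ i f, P i f ⊆ stdSimplex ℝ (S i)
  P_polyhedral : ∀ i f, IsPolyhedron (P i f)
  P_nonempty : ∀ i s a, (P i (φ s a)).Nonempty
  /-- the rewards -/
  r : Φ → ℝ
  /-- the discount factor -/
  γ : ℝ
  γ_pos : 0 < γ
  γ_lt_one : γ < 1

namespace RFMDP

section Objectives

variable {ι : Type} [Fintype ι] [DecidableEq ι] {S : ι → Type} [∀ i, Fintype (S i)] {A Φ : Type}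

/-- The expected total reward of the stationary policy `π` under the transition kernel `p`. -/
def value (R : RFMDP S A Φ) (π : (∀ i, S i) → A) (p : Φ → stdSimplex ℝ (∀ i, S i)) : ℝ :=
  expectedTotalReward (productDistribution R.q) (fun s => p (R.φ s (π s)))
    (fun s => R.r (R.φ s (π s))) R.γ

/-- The non-factored ambiguity set `𝒫^NF`: all marginals lie in the marginal ambiguity sets. -/
def nonFactoredSet (R : RFMDP S A Φ) : Set (Φ → stdSimplex ℝ (∀ i, S i)) :=
  {p | ∀ s a i, marg (p (R.φ s a)) i ∈ R.P i (R.φ s a)}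

/-- The factored ambiguity set `𝒫^F`: products of elements of the marginal ambiguity sets. -/
def factoredSet (R : RFMDP S A Φ) : Set (Φ → stdSimplex ℝ (∀ i, S i)) :=
  {p | ∀ s a, ∃ pm : ∀ i, S i → ℝ, (∀ i, pm i ∈ R.P i (R.φ s a)) ∧
    ∀ s' : ∀ i, S i, p (R.φ s a) s' = ∏ i, pm i (s' i)}

/-- The non-factored objective `NF(π)`. -/
def NF (R : RFMDP S A Φ) (π : (∀ i, S i) → A) : ℝ := ⨅ p : R.nonFactoredSet, R.value π p

/-- The factored objective `F(π)`. -/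
def F (R : RFMDP S A Φ) (π : (∀ i, S i) → A) : ℝ := ⨅ p : R.factoredSet, R.value π p

/-- The optimal value `NF*`. -/
def NFopt (R : RFMDP S A Φ) : ℝ := ⨆ π, R.NF π

/-- The optimal value `F*`. -/
def Fopt (R : RFMDP S A Φ) : ℝ := ⨆ π, R.F π

/-- All rewards are `0` or `1`. -/
def ZeroOneRewards (R : RFMDP S A Φ) : Prop :=
  ∀ s a, R.r (R.φ s a) = 0 ∨ R.r (R.φ s a) = 1

end Objectives

end RFMDP

/-! ### The lift -/

/-- The `2N + 2` sub-states of the lift: `N` for the update block, `N` for the memory block, one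
for the action block, one for the timer block. -/
inductive LiftIdx (N : ℕ) : Type
  | upd (k : Fin N)
  | mem (k : Fin N)
  | act
  | timer
  deriving DecidableEq, Fintype

/-- The sub-state spaces of the lift. The timer values `1, …, N` are represented by
`0, …, N - 1 : Fin N`. -/
def LiftSub {N : ℕ} (S : Fin N → Type) (A : Type) : LiftIdx N → Type
  | .upd k => S k
  | .mem k => S k
  | .act => A
  | .timer => Fin N

instance liftSubFintype {N : ℕ} (S : Fin N → Type) [∀ n, Fintype (S n)] (A : Type) [Fintype A] :
    ∀ i, Fintype (LiftSub S A i)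
  | .upd k => inferInstanceAs (Fintype (S k))
  | .mem k => inferInstanceAs (Fintype (S k))
  | .act => inferInstanceAs (Fintype A)
  | .timer => inferInstanceAs (Fintype (Fin N))

/-- The lifted state space. -/
abbrev LiftState {N : ℕ} (S : Fin N → Type) (A : Type) : Type := ∀ i, LiftSub S A i

namespace LiftState

variable {N : ℕ} {S : Fin N → Type} {A : Type}

/-- The lifted state `(u, m, a, n)`. -/
def mk (u m : ∀ n, S n) (a : A) (n : Fin N) : LiftState S A
  | .upd k => u k
  | .mem k => m k
  | .act => a
  | .timer => n

/-- The update block. -/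
def u (x : LiftState S A) : ∀ n, S n := fun k => x (.upd k)

/-- The memory block. -/
def m (x : LiftState S A) : ∀ n, S n := fun k => x (.mem k)

/-- The action block. -/
def a (x : LiftState S A) : A := x .act

/-- The timer block. -/
def n (x : LiftState S A) : Fin N := x .timer

end LiftState

/-- The values of the lifted feature map: the lifted state, the lifted action, and the features
`φ(u, â)` and `φ(m, a)`. -/
structure LiftFeature {N : ℕ} (S : Fin N → Type) (A Φ : Type) where
  state : LiftState S A
  action : A
  fu : Φ
  fm : Φ

section PointMass

variable {X : Type} [Fintype X]

open Classical in
/-- The Dirac distribution at `x`. -/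
def pointMass (x : X) : stdSimplex ℝ X :=
  ⟨fun y => if y = x then 1 else 0, fun y => by dsimp only; split_ifs <;> norm_num, by simp⟩

end PointMass

namespace RFMDP

section Lift

variable {N : ℕ} [NeZero N] {S : Fin N → Type} [∀ n, Fintype (S n)] {A : Type} [Fintype A]
  {Φ : Type}

/-- The marginal ambiguity set of the `k`-th sub-state of the update block: it is updated by a
distribution from the `k`-th marginal ambiguity set of `R` if the timer is at `k`, and left
unchanged otherwise. -/
def updP (R : RFMDP S A Φ) (k : Fin N) (f : LiftFeature S A Φ) : Set (S k → ℝ) :=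
  if f.state.n = k then R.P k (if k = 0 then f.fu else f.fm)
  else {(pointMass (f.state.u k)).1}

/-- The marginal ambiguity sets of the lift. With the timer in `Fin N`, `n = 0` is the first
and `n + 1 = 0` the last of the `N` consecutive transitions that make up one transition of `R`. -/
def liftP (R : RFMDP S A Φ) (s₀ : ∀ n, S n) (a₀ : A) :
    ∀ i, LiftFeature S A Φ → Set (LiftSub S A i → ℝ)
  | .upd k, f => R.updP k f
  | .mem k, f =>
      {(pointMass (if f.state.n + 1 = 0 then s₀ k
        else if f.state.n = 0 then f.state.u k else f.state.m k)).1}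
  | .act, f =>
      {(pointMass (if f.state.n + 1 = 0 then a₀
        else if f.state.n = 0 then f.action else f.state.a)).1}
  | .timer, f => {(pointMass (f.state.n + 1)).1}

/-- The initial distributions of the sub-states of the lift. -/
def liftq (R : RFMDP S A Φ) (s₀ : ∀ n, S n) (a₀ : A) : ∀ i, stdSimplex ℝ (LiftSub S A i)
  | .upd k => R.q k
  | .mem k => pointMass (s₀ k)
  | .act => pointMass a₀
  | .timer => pointMass (0 : Fin N)

open Classical in
/-- The lift of `R` relative to the fixed state `s₀` and action `a₀`. -/
def lift (R : RFMDP S A Φ) (s₀ : ∀ n, S n) (a₀ : A) :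
    RFMDP (LiftSub S A) A (LiftFeature S A Φ) where
  φ x b := ⟨x, b, R.φ (LiftState.u x) b, R.φ (LiftState.m x) (LiftState.a x)⟩
  q := R.liftq s₀ a₀
  P := R.liftP s₀ a₀
  P_subset := by
    rintro (k | k | _ | _) f
    · change R.updP k f ⊆ stdSimplex ℝ (S k)
      unfold updP
      split
      · exact R.P_subset _ _
      · exact Set.singleton_subset_iff.2 (Subtype.property _)
    all_goals exact Set.singleton_subset_iff.2 (Subtype.property _)
  P_polyhedral := by
    rintro (k | k | _ | _) f
    · change IsPolyhedron (R.updP k f)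
      unfold updP
      split
      · exact R.P_polyhedral _ _
      · exact isPolyhedron_singleton (X := S k) _
    · exact isPolyhedron_singleton (X := S k) _
    · exact isPolyhedron_singleton (X := A) _
    · exact isPolyhedron_singleton (X := Fin N) _
  P_nonempty := by
    rintro (k | k | _ | _) x b
    · change (R.updP k ⟨x, b, R.φ (LiftState.u x) b, R.φ (LiftState.m x) (LiftState.a x)⟩).Nonempty
      unfold updP
      split
      · by_cases h : k = 0
        · simpa [h] using R.P_nonempty _ _ _
        · simpa [h] using R.P_nonempty _ _ _
      · exact Set.singleton_nonempty _
    all_goals exact Set.singleton_nonempty _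
  r f := if f.state.m = s₀ ∧ f.state.a = a₀ ∧ f.state.n = 0 then R.r f.fu else 0
  γ := R.γ ^ (1 / (N : ℝ))
  γ_pos := Real.rpow_pos_of_pos R.γ_pos _
  γ_lt_one := Real.rpow_lt_one R.γ_pos.le R.γ_lt_one
    (one_div_pos.2 (Nat.cast_pos.2 (Nat.pos_of_ne_zero (NeZero.ne N))))

/-- The lifted non-factored objective `L(π̂)`. -/
def L (R : RFMDP S A Φ) (s₀ : ∀ n, S n) (a₀ : A) (πl : LiftState S A → A) : ℝ :=
  (R.lift s₀ a₀).NF πl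

/-- The optimal value `L*`. -/
def Lopt (R : RFMDP S A Φ) (s₀ : ∀ n, S n) (a₀ : A) : ℝ := ⨆ πl, R.L s₀ a₀ πl

end Lift

end RFMDP

/-- The set `Π̂(π)` of lifted policies associated with the policy `π`. -/
def liftedPolicies {N : ℕ} [NeZero N] {S : Fin N → Type} {A : Type} (s₀ : ∀ n, S n) (a₀ : A)
    (π : (∀ n, S n) → A) : Set (LiftState S A → A) :=
  {πl | ∀ u : ∀ n, S n, πl (LiftState.mk u s₀ a₀ 0) = π u}

/-- RFMDP instances with `N` binary sub-states, actions in `A ⊆ {0,1}^k` and features in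
`{0,1}^F`. -/
abbrev BinaryRFMDP (N : ℕ) {k : ℕ} (A : Finset (Fin k → Bool)) (F : ℕ) :=
  RFMDP (fun _ : Fin N => Bool) A (Fin F → Bool)

end

noncomputable section

/-! ### The discounted reward of a finite Markov chain -/

section Chain

variable {X : Type} [Fintype X]

/-! Nature minimises the reward. The three models differ in how the components of the next state may
depend on each other: arbitrarily in NF, not at all in F. The lift spreads one transition over N
steps, and nature draws component n knowing the earlier ones, but with a conditional law that must
stay in `P n`. Ignoring the earlier draws reproduces a factored kernel, so L ≤ F. Conversely, the N
draws have a joint law whose n-th marginal is a mixture of elements of `P n`; polyhedra are convex,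
so this law is admissible for NF, and NF ≤ L.

The proof does not translate kernels between the models but compares sub- and supersolutions of
Bellman equations (`le_chainValue`, `chainValue_le`). For the lift, `RFMDP.le_L` and `RFMDP.L_le`
reduce these to a function `V` on the original states and functions `G n u f`, the values in
mid-cycle when the components of `u` below n are drawn and the governing feature is `f`. For NF ≤ L,
`V` solves the robust Bellman equation and `G` is the lower expectation over `partialSet`; for L ≤
F, `V` is the value of a factored kernel and `G` is `tailExp`.

In the examples neither rewards nor transition laws depend on the action, and each component is
either a forced fair coin or free. Values are γκ/(1-γ), where κ is the worst expected one-step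
reward. Only the order of the draws matters: in the lift, a free component can copy an earlier coin,
but a later coin cannot. Rewarding disagreement with a later coin separates NF from L; rewarding
disagreement with a later free component separates L from F. Switching the two rewards on and off
gives the four patterns. Part (ii) uses pairs of a coin and a later free component, part (iii) uses
coins only. -/

theorem integral_simplexMeasure [MeasurableSpace X] [DiscreteMeasurableSpace X]
    (p : stdSimplex ℝ X) (f : X → ℝ) : ∫ x, f x ∂(simplexMeasure p) = ∑ x, p x * f x := by
  have hsm : StronglyMeasurable f := (measurable_of_countable f).stronglyMeasurable
  rw [simplexMeasure, integral_finsetSum_measure]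
  · refine Finset.sum_congr rfl fun x _ => ?_
    have hp : (ENNReal.ofReal (p x)).toReal = p x := ENNReal.toReal_ofReal (p.2.1 x)
    rw [integral_smul_measure, integral_dirac' f x hsm, hp, smul_eq_mul]
  · intro x _
    exact (integrable_dirac' hsm (by simp)).smul_measure ENNReal.ofReal_ne_top

/-- The transition operator `f ↦ (x ↦ ∑ y, K(y | x) f(y))`. -/
def transOp (K : X → stdSimplex ℝ X) (f : X → ℝ) : X → ℝ := fun x => ∑ y, K x y * f y

/-- Comparison on the support suffices, which is why Bellman inequalities need only be checked on a
closed set of states. -/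
theorem simplex_sum_le {p : stdSimplex ℝ X} {f g : X → ℝ} (h : ∀ x, p x ≠ 0 → f x ≤ g x) :
    ∑ x, p x * f x ≤ ∑ x, p x * g x := by
  refine Finset.sum_le_sum fun x _ => ?_
  by_cases hx : p x = 0
  · simp [hx]
  · exact mul_le_mul_of_nonneg_left (h x hx) (p.2.1 x)

theorem simplex_sum_const (p : stdSimplex ℝ X) (a : ℝ) : ∑ x, p x * a = a := by
  rw [← Finset.sum_mul]
  have : ∑ x, p x = 1 := p.2.2
  rw [this, one_mul]

theorem abs_simplex_sum_le {p : stdSimplex ℝ X} {f : X → ℝ} {C : ℝ} (h : ∀ x, |f x| ≤ C) :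
    |∑ x, p x * f x| ≤ C := by
  rw [abs_le]
  constructor
  · rw [← simplex_sum_const p (-C)]
    exact simplex_sum_le fun x _ => (abs_le.1 (h x)).1
  · rw [← simplex_sum_const p C]
    exact simplex_sum_le fun x _ => (abs_le.1 (h x)).2

theorem abs_transOp_iterate_le (K : X → stdSimplex ℝ X) {f : X → ℝ} {C : ℝ} (h : ∀ x, |f x| ≤ C)
    (t : ℕ) (x : X) : |(transOp K)^[t] f x| ≤ C := by
  induction t generalizing x with
  | zero => exact h x
  | succ t ih =>
    rw [Function.iterate_succ_apply']
    exact abs_simplex_sum_le ih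

theorem exists_abs_le (f : X → ℝ) : ∃ C, ∀ x, |f x| ≤ C :=
  ⟨∑ x, |f x|, fun x => Finset.single_le_sum (f := fun x => |f x|) (fun _ _ => abs_nonneg _)
    (Finset.mem_univ x)⟩

/-! ### Laws of the chain at fixed times -/

section Law

variable [MeasurableSpace X] [DiscreteMeasurableSpace X]

instance chainLaw_isProbabilityMeasure (q : stdSimplex ℝ X) (K : X → stdSimplex ℝ X) :
    IsProbabilityMeasure (chainLaw q K) := by
  unfold chainLaw
  infer_instance

theorem integrable_chainLaw_eval (q : stdSimplex ℝ X) (K : X → stdSimplex ℝ X) (f : X → ℝ)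
    (t : ℕ) : Integrable (fun ω => f (ω t)) (chainLaw q K) := by
  obtain ⟨C, hC⟩ := exists_abs_le f
  refine Integrable.of_bound (C := C) ?_ (Filter.Eventually.of_forall fun ω => hC (ω t))
  exact ((measurable_of_countable f).comp (measurable_pi_apply t)).aestronglyMeasurable

theorem integral_chainLaw_zero (q : stdSimplex ℝ X) (K : X → stdSimplex ℝ X) (f : X → ℝ) :
    ∫ ω, f (ω 0) ∂(chainLaw q K) = ∑ x, q x * f x := by
  have hf : Measurable f := measurable_of_countable f
  rw [← integral_simplexMeasure]
  have h : (chainLaw q K).map (fun ω => ω 0) = simplexMeasure q := by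
    unfold chainLaw Kernel.trajMeasure
    have h0 : (fun ω : ℕ → X => ω 0) =
      (fun z : ((i : Finset.Iic 0) → X) => z ⟨0, by simp⟩) ∘ Preorder.frestrictLe 0 := rfl
    rw [h0, ← Measure.map_map (by fun_prop) (by fun_prop), Measure.map_comp _ _ (by fun_prop),
      Kernel.traj_map_frestrictLe, Kernel.partialTraj_self, Measure.id_comp,
      Measure.map_map (by fun_prop) (by fun_prop)]
    convert! Measure.map_id
  rw [← h, integral_map (measurable_pi_apply 0).aemeasurable hf.aestronglyMeasurable]

/-- Markov property: the joint law of the path up to `t` and the state at `t + 1` is a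
composition-product with the one-step kernel, so the last state can be integrated out first. -/
theorem integral_chainLaw_succ (q : stdSimplex ℝ X) (K : X → stdSimplex ℝ X) (f : X → ℝ) (t : ℕ) :
    ∫ ω, f (ω (t + 1)) ∂(chainLaw q K) = ∫ ω, transOp K f (ω t) ∂(chainLaw q K) := by
  have hf : Measurable f := measurable_of_countable f
  have hT : Measurable (transOp K f) := measurable_of_countable _
  let κ : (t : ℕ) → Kernel ((i : Finset.Iic t) → X) X := fun t =>
    (stepKernel K).comap (fun ω : (i : Finset.Iic t) → X => ω ⟨t, Finset.mem_Iic.2 le_rfl⟩)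
      (measurable_pi_apply _)
  have key := Kernel.map_frestrictLe_trajMeasure_compProd_eq_map_trajMeasure
    (X := fun _ => X) (μ₀ := simplexMeasure q) (κ := κ) (a := t)
  change (chainLaw q K).map (Preorder.frestrictLe t) ⊗ₘ κ t =
    (chainLaw q K).map (fun x ↦ (Preorder.frestrictLe t x, x (t + 1))) at key
  have hm : Measurable fun x : ℕ → X ↦ (Preorder.frestrictLe (π := fun _ => X) t x, x (t + 1)) :=
    (Preorder.measurable_frestrictLe t).prodMk (measurable_pi_apply _)
  have h1 : ∫ ω, f (ω (t + 1)) ∂(chainLaw q K) =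
      ∫ z, f z.2 ∂((chainLaw q K).map
        (fun x ↦ (Preorder.frestrictLe (π := fun _ => X) t x, x (t + 1)))) :=
    (integral_map (f := fun z : ((i : Finset.Iic t) → X) × X => f z.2) hm.aemeasurable
      (hf.comp measurable_snd).aestronglyMeasurable).symm
  have hP : IsProbabilityMeasure ((chainLaw q K).map (Preorder.frestrictLe (π := fun _ => X) t)) :=
    Measure.isProbabilityMeasure_map (by fun_prop)
  rw [h1, ← key, Measure.integral_compProd]
  · rw [integral_map (by fun_prop)]
    · refine integral_congr_ae (Filter.Eventually.of_forall fun ω => ?_)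
      exact integral_simplexMeasure (K (ω t)) f
    · refine Measurable.aestronglyMeasurable ?_
      have : (fun x => ∫ y, f y ∂(κ t x)) =
          fun x => transOp K f (x ⟨t, Finset.mem_Iic.2 le_rfl⟩) :=
        funext fun x => integral_simplexMeasure _ f
      rw [this]
      exact hT.comp (measurable_pi_apply _)
  · obtain ⟨C, hC⟩ := exists_abs_le f
    exact Integrable.of_bound (C := C) (hf.comp measurable_snd).aestronglyMeasurable
      (Filter.Eventually.of_forall fun z => hC z.2)

theorem integral_chainLaw (q : stdSimplex ℝ X) (K : X → stdSimplex ℝ X) (f : X → ℝ) (t : ℕ) :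
    ∫ ω, f (ω t) ∂(chainLaw q K) = ∑ x, q x * (transOp K)^[t] f x := by
  induction t generalizing f with
  | zero => exact integral_chainLaw_zero q K f
  | succ t ih => rw [integral_chainLaw_succ, ih, Function.iterate_succ_apply]

end Law

/-- The expected total reward as a function of the initial state. -/
def chainValue (K : X → stdSimplex ℝ X) (c : X → ℝ) (γ : ℝ) : X → ℝ :=
  fun x => ∑' t : ℕ, γ ^ t * (transOp K)^[t] c x

variable {γ : ℝ}

theorem summable_chainValue (hγ : 0 < γ) (hγ1 : γ < 1) (K : X → stdSimplex ℝ X) (c : X → ℝ)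
    (x : X) : Summable fun t : ℕ => γ ^ t * (transOp K)^[t] c x := by
  obtain ⟨C, hC⟩ := exists_abs_le c
  refine Summable.of_norm_bounded ((summable_geometric_of_lt_one hγ.le hγ1).mul_right C)
    fun t => ?_
  rw [norm_mul, Real.norm_of_nonneg (pow_nonneg hγ.le t)]
  exact mul_le_mul_of_nonneg_left (abs_transOp_iterate_le K hC t x) (pow_nonneg hγ.le t)

/-- Sum and integral are exchanged because the t-th term is bounded by γ^t C. This removes all
measure theory from what follows. -/
theorem expectedTotalReward_eq (hγ : 0 < γ) (hγ1 : γ < 1) (q : stdSimplex ℝ X)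
    (K : X → stdSimplex ℝ X) (c : X → ℝ) :
    expectedTotalReward q K c γ = ∑ x, q x * chainValue K c γ x := by
  let _ : MeasurableSpace X := ⊤
  obtain ⟨C, hC⟩ := exists_abs_le c
  change ∫ ω, ∑' t : ℕ, γ ^ t * c (ω t) ∂(chainLaw q K) = _
  have hint : ∀ t, Integrable (fun ω => γ ^ t * c (ω t)) (chainLaw q K) := fun t =>
    (integrable_chainLaw_eval q K c t).const_mul _
  rw [← integral_tsum_of_summable_integral_norm hint]
  · simp only [integral_const_mul, integral_chainLaw, chainValue, ← tsum_mul_left]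
    rw [← Summable.tsum_finsetSum fun x _ => (summable_chainValue hγ hγ1 K c x).mul_left (q x)]
    refine tsum_congr fun t => ?_
    rw [Finset.mul_sum]
    exact Finset.sum_congr rfl fun x _ => by ring
  · refine Summable.of_nonneg_of_le (fun t => by positivity) (fun t => ?_)
      ((summable_geometric_of_lt_one hγ.le hγ1).mul_right C)
    have hb : ∀ ω : ℕ → X, ‖γ ^ t * c (ω t)‖ ≤ γ ^ t * C := fun ω => by
      rw [norm_mul, Real.norm_of_nonneg (pow_nonneg hγ.le t)]
      exact mul_le_mul_of_nonneg_left (hC _) (pow_nonneg hγ.le t)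
    refine (integral_mono (hint t).norm (integrable_const (γ ^ t * C)) hb).trans ?_
    simp

/-- The Bellman equation. -/
theorem chainValue_bellman (hγ : 0 < γ) (hγ1 : γ < 1) (K : X → stdSimplex ℝ X) (c : X → ℝ)
    (x : X) : chainValue K c γ x = c x + γ * ∑ y, K x y * chainValue K c γ y := by
  unfold chainValue
  rw [(summable_chainValue hγ hγ1 K c x).tsum_eq_zero_add]
  congr 1
  · simp
  · simp only [← tsum_mul_left]
    rw [← Summable.tsum_finsetSum fun y _ =>
      (summable_chainValue hγ hγ1 K c y).mul_left (K x y), ← tsum_mul_left]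
    refine tsum_congr fun t => ?_
    rw [Function.iterate_succ_apply', transOp, Finset.mul_sum, Finset.mul_sum]
    exact Finset.sum_congr rfl fun y _ => by ring

theorem transOp_iterate_neg (K : X → stdSimplex ℝ X) (c : X → ℝ) (t : ℕ) :
    (transOp K)^[t] (-c) = -((transOp K)^[t] c) := by
  induction t generalizing c with
  | zero => rfl
  | succ t ih =>
    rw [Function.iterate_succ_apply, Function.iterate_succ_apply, ← ih]
    congr 1
    funext x
    simp [transOp]

theorem chainValue_neg (K : X → stdSimplex ℝ X) (c : X → ℝ) (x : X) :
    chainValue K (-c) γ x = -chainValue K c γ x := by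
  simp [chainValue, transOp_iterate_neg, tsum_neg]

/-- A subsolution of the Bellman equation on a closed set of states is a lower bound. -/
theorem le_chainValue (hγ : 0 < γ) (hγ1 : γ < 1) (K : X → stdSimplex ℝ X) (c V : X → ℝ)
    (I : Set X) (hI : ∀ x ∈ I, ∀ y, K x y ≠ 0 → y ∈ I)
    (hV : ∀ x ∈ I, V x ≤ c x + γ * ∑ y, K x y * V y) {x : X} (hx : x ∈ I) :
    V x ≤ chainValue K c γ x := by
  obtain ⟨C, hC⟩ := exists_abs_le fun x => V x - chainValue K c γ x
  -- By the Bellman equation the gap at a state is at most γ times an average of the gaps at its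
  -- successors, which remain in `I`.
  have hstep : ∀ t : ℕ, ∀ x ∈ I, V x - chainValue K c γ x ≤ γ ^ t * C := by
    intro t
    induction t with
    | zero => intro x _; simpa using (abs_le.1 (hC x)).2
    | succ t ih =>
      intro x hx
      have h1 := hV x hx
      have h2 := chainValue_bellman hγ hγ1 K c x
      have h3 : ∑ y, K x y * (V y - chainValue K c γ y) ≤ γ ^ t * C := by
        rw [← simplex_sum_const (K x) (γ ^ t * C)]
        exact simplex_sum_le fun y hy => ih y (hI x hx y hy)
      simp only [mul_sub, Finset.sum_sub_distrib] at h3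
      have h4 := mul_le_mul_of_nonneg_left h3 hγ.le
      rw [mul_sub, ← mul_assoc, ← pow_succ'] at h4
      linarith
  have hlim : Filter.Tendsto (fun t : ℕ => γ ^ t * C) Filter.atTop (nhds (0 * C)) :=
    (tendsto_pow_atTop_nhds_zero_of_lt_one hγ.le hγ1).mul_const C
  have := ge_of_tendsto' hlim fun t => hstep t x hx
  linarith

/-- A supersolution of the Bellman equation on a closed set of states is an upper bound. -/
theorem chainValue_le (hγ : 0 < γ) (hγ1 : γ < 1) (K : X → stdSimplex ℝ X) (c V : X → ℝ)
    (I : Set X) (hI : ∀ x ∈ I, ∀ y, K x y ≠ 0 → y ∈ I)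
    (hV : ∀ x ∈ I, c x + γ * ∑ y, K x y * V y ≤ V x) {x : X} (hx : x ∈ I) :
    chainValue K c γ x ≤ V x := by
  have := le_chainValue hγ hγ1 K (-c) (-V) I hI (fun x hx => by
    have := hV x hx
    simp only [Pi.neg_apply, mul_neg, Finset.sum_neg_distrib]
    linarith) hx
  rw [chainValue_neg, Pi.neg_apply] at this
  linarith

theorem le_expectedTotalReward (hγ : 0 < γ) (hγ1 : γ < 1) (q : stdSimplex ℝ X)
    (K : X → stdSimplex ℝ X) (c V : X → ℝ) (I : Set X) (hq : ∀ x, q x ≠ 0 → x ∈ I)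
    (hI : ∀ x ∈ I, ∀ y, K x y ≠ 0 → y ∈ I)
    (hV : ∀ x ∈ I, V x ≤ c x + γ * ∑ y, K x y * V y) :
    ∑ x, q x * V x ≤ expectedTotalReward q K c γ := by
  rw [expectedTotalReward_eq hγ hγ1]
  exact simplex_sum_le fun x hx => le_chainValue hγ hγ1 K c V I hI hV (hq x hx)

theorem expectedTotalReward_le (hγ : 0 < γ) (hγ1 : γ < 1) (q : stdSimplex ℝ X)
    (K : X → stdSimplex ℝ X) (c V : X → ℝ) (I : Set X) (hq : ∀ x, q x ≠ 0 → x ∈ I)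
    (hI : ∀ x ∈ I, ∀ y, K x y ≠ 0 → y ∈ I)
    (hV : ∀ x ∈ I, c x + γ * ∑ y, K x y * V y ≤ V x) :
    expectedTotalReward q K c γ ≤ ∑ x, q x * V x := by
  rw [expectedTotalReward_eq hγ hγ1]
  exact simplex_sum_le fun x hx => chainValue_le hγ hγ1 K c V I hI hV (hq x hx)

end Chain

/-! ### Marginals and product distributions -/

section Marginals

variable {ι : Type} [Fintype ι] [DecidableEq ι] {S : ι → Type} [∀ i, Fintype (S i)]

theorem sum_mul_comp_eq_sum_marg (p : stdSimplex ℝ (∀ i, S i)) (i : ι) (g : S i → ℝ) :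
    ∑ s, p s * g (s i) = ∑ σ, marg p i σ * g σ := by
  classical
  simp only [marg, Finset.sum_mul]
  rw [Finset.sum_comm]
  refine Finset.sum_congr rfl fun s _ => ?_
  simp only [ite_mul, zero_mul]
  rw [Finset.sum_ite_eq]
  simp

theorem marg_mem_stdSimplex (p : stdSimplex ℝ (∀ i, S i)) (i : ι) :
    marg p i ∈ stdSimplex ℝ (S i) := by
  refine ⟨fun σ => Finset.sum_nonneg fun s _ => ?_, ?_⟩
  · split_ifs
    exacts [p.2.1 s, le_rfl]
  · have h := sum_mul_comp_eq_sum_marg p i fun _ => 1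
    simp only [mul_one] at h
    rw [← h]
    exact p.2.2

theorem apply_eq_of_marg_eq_pointMass {p : stdSimplex ℝ (∀ i, S i)} {i : ι} {a : S i}
    (h : marg p i = (pointMass a).1) {s : ∀ i, S i} (hs : p s ≠ 0) : s i = a := by
  classical
  by_contra hne
  have h1 : marg p i (s i) = 0 := by
    rw [h]
    simp [pointMass, hne]
  have h2 : p s ≤ marg p i (s i) := by
    have := Finset.single_le_sum (f := fun s' => if s' i = s i then p s' else 0)
      (fun s' _ => by
        split_ifs
        exacts [p.2.1 s', le_rfl]) (Finset.mem_univ s)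
    simpa [marg] using this
  exact hs (le_antisymm (h2.trans h1.le) (p.2.1 s))

/-- Resampling one component of a product distribution does not change expectations. -/
theorem sum_prod_resample (q : ∀ i, S i → ℝ) (k : ι) (hk : ∑ σ, q k σ = 1) (f : (∀ i, S i) → ℝ) :
    ∑ s : ∀ i, S i, (∏ i, q i (s i)) * f s =
      ∑ σ, q k σ * ∑ s : ∀ i, S i, (∏ i, q i (s i)) * f (Function.update s k σ) := by
  -- Swapping the fresh sample with the k-th component is an involution that preserves the joint
  -- weight.
  let e : S k × (∀ i, S i) → S k × (∀ i, S i) := fun z => (z.2 k, Function.update z.2 k z.1)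
  have he : Function.Involutive e := fun z => by simp [e]
  have hw : ∀ z : S k × (∀ i, S i), q k (e z).1 * ∏ i, q i ((e z).2 i) =
      q k z.1 * ∏ i, q i (z.2 i) := by
    intro z
    rw [Fintype.prod_eq_mul_prod_compl k, Fintype.prod_eq_mul_prod_compl k]
    have : ∏ i ∈ ({k} : Finset ι)ᶜ, q i ((e z).2 i) = ∏ i ∈ ({k} : Finset ι)ᶜ, q i (z.2 i) :=
      Finset.prod_congr rfl fun i hi => by
        have hik : i ≠ k := by simpa using hi
        simp [e, Function.update_of_ne hik]
    rw [this]
    simp only [e, Function.update_self]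
    ring
  have h1 : ∑ z : S k × (∀ i, S i), q k z.1 * (∏ i, q i (z.2 i)) * f (Function.update z.2 k z.1) =
      ∑ z : S k × (∀ i, S i), q k z.1 * (∏ i, q i (z.2 i)) * f z.2 := by
    rw [← Equiv.sum_comp he.toPerm]
    refine Finset.sum_congr rfl fun z _ => ?_
    change q k (e z).1 * (∏ i, q i ((e z).2 i)) * f (Function.update (e z).2 k (e z).1) = _
    rw [hw]
    simp [e]
  simp only [Finset.mul_sum, ← mul_assoc]
  rw [← Fintype.sum_prod_type'
    (f := fun σ s => q k σ * (∏ i, q i (s i)) * f (Function.update s k σ)), h1,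
    Fintype.sum_prod_type, Finset.sum_comm]
  refine Finset.sum_congr rfl fun s _ => ?_
  dsimp only
  rw [← Finset.sum_mul, ← Finset.sum_mul, hk, one_mul]

theorem marg_productDistribution (q : ∀ i, stdSimplex ℝ (S i)) (i : ι) :
    marg (productDistribution q) i = (q i).1 := by
  classical
  funext τ
  have h := sum_prod_resample (fun i => (q i).1) i (q i).2.2 fun s => if s i = τ then 1 else 0
  have h1 : ∑ s : ∀ i, S i, ∏ i, (q i).1 (s i) = 1 := (productDistribution q).2.2
  simp only [Function.update_self, ← Finset.sum_mul, h1, one_mul] at h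
  simp only [mul_ite, mul_one, mul_zero, Finset.sum_ite_eq', Finset.mem_univ, if_true] at h
  exact (Finset.sum_congr rfl fun s _ => by congr).trans h

/-- Convexity is all that is needed of polyhedrality: it keeps mixtures of admissible marginals
admissible. -/
theorem isPolyhedron_convex {X : Type} [Fintype X] {C : Set (X → ℝ)} (hC : IsPolyhedron C) :
    Convex ℝ C := by
  obtain ⟨m, G, h, rfl⟩ := hC
  intro x hx y hy a b ha hb hab i
  have h1 := mul_le_mul_of_nonneg_left (hx i) ha
  have h2 := mul_le_mul_of_nonneg_left (hy i) hb
  rw [Matrix.mulVec_add, Matrix.mulVec_smul, Matrix.mulVec_smul]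
  simp only [Pi.add_apply, Pi.smul_apply, smul_eq_mul]
  calc _ ≤ a * h i + b * h i := add_le_add h1 h2
    _ = h i := by rw [← add_mul, hab, one_mul]

/-- The mixture of the distributions `ρ y` with weights `p y`. -/
def mixture {X Y : Type} [Fintype X] [Fintype Y] (p : stdSimplex ℝ Y) (ρ : Y → stdSimplex ℝ X) :
    stdSimplex ℝ X :=
  ⟨∑ y, p y • (ρ y).1, (convex_stdSimplex ℝ X).sum_mem (fun y _ => p.2.1 y) p.2.2
    fun y _ => (ρ y).2⟩

theorem mixture_apply {X Y : Type} [Fintype X] [Fintype Y] (p : stdSimplex ℝ Y)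
    (ρ : Y → stdSimplex ℝ X) (x : X) : mixture p ρ x = ∑ y, p y * ρ y x := by
  change (∑ y, p y • (ρ y).1) x = _
  rw [Finset.sum_apply]
  rfl

theorem sum_mixture_mul {X Y : Type} [Fintype X] [Fintype Y] (p : stdSimplex ℝ Y)
    (ρ : Y → stdSimplex ℝ X) (V : X → ℝ) :
    ∑ x, mixture p ρ x * V x = ∑ y, p y * ∑ x, ρ y x * V x := by
  simp only [mixture_apply, Finset.sum_mul, Finset.mul_sum]
  rw [Finset.sum_comm]
  exact Finset.sum_congr rfl fun _ _ => Finset.sum_congr rfl fun _ _ => by ring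

theorem marg_mixture {Y : Type} [Fintype Y] (p : stdSimplex ℝ Y)
    (ρ : Y → stdSimplex ℝ (∀ i, S i)) (i : ι) :
    marg (mixture p ρ) i = ∑ y, p y • marg (ρ y) i := by
  classical
  funext σ
  have h := sum_mixture_mul p ρ fun s => if s i = σ then 1 else 0
  simp only [mul_ite, mul_one, mul_zero] at h
  rw [Finset.sum_apply]
  simp only [Pi.smul_apply, smul_eq_mul, marg]
  convert h

theorem sum_pointMass_mul {X : Type} [Fintype X] (x : X) (V : X → ℝ) :
    ∑ y, pointMass x y * V y = V x := by
  classical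
  have : ∀ y, pointMass x y = if y = x then 1 else 0 := fun y => by
    change (if y = x then (1 : ℝ) else 0) = _
    congr
  simp [this]

theorem marg_pointMass (s : ∀ i, S i) (i : ι) : marg (pointMass s) i = (pointMass (s i)).1 := by
  classical
  funext σ
  have h := sum_pointMass_mul s fun s' => if s' i = σ then 1 else 0
  simp only [mul_ite, mul_one, mul_zero] at h
  refine (Finset.sum_congr rfl fun s _ => by congr).trans (h.trans ?_)
  simp [pointMass, eq_comm]

theorem sum_smul_pointMass {X : Type} [Fintype X] (p : X → ℝ) :
    ∑ x, p x • (pointMass x).1 = p := by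
  classical
  funext y
  rw [Finset.sum_apply]
  simp [pointMass]

/-- The expectation of `V` when the components `≥ n` of `u` are replaced by independent samples. -/
def tailExp {N : ℕ} {S : Fin N → Type} [∀ i, Fintype (S i)] (q : ∀ i, S i → ℝ)
    (V : (∀ i, S i) → ℝ) (n : ℕ) (u : ∀ i, S i) : ℝ :=
  ∑ s : ∀ i, S i, (∏ i, q i (s i)) * V fun i => if i.val < n then u i else s i

/-! ### Drawing the components of a product distribution one at a time -/

section Tail

variable {N : ℕ} {T : Fin N → Type} [∀ i, Fintype (T i)] (q : ∀ i, T i → ℝ) (V : (∀ i, T i) → ℝ)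

theorem tailExp_zero (u : ∀ i, T i) :
    tailExp q V 0 u = ∑ s : ∀ i, T i, (∏ i, q i (s i)) * V s := by
  simp [tailExp]

theorem tailExp_last (hq : ∀ i, ∑ σ, q i σ = 1) (u : ∀ i, T i) : tailExp q V N u = V u := by
  have h1 : ∑ s : ∀ i, T i, ∏ i, q i (s i) = 1 := by
    rw [← Fintype.prod_sum]
    exact Finset.prod_eq_one fun i _ => hq i
  simp [tailExp, ← Finset.sum_mul, h1]

/-- Resampling component n exposes its value as an outer sum; the components below n are read from
`u` and do not notice. -/
theorem tailExp_step (n : Fin N) (hq : ∑ σ, q n σ = 1) (u : ∀ i, T i) :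
    tailExp q V n u = ∑ σ, q n σ * tailExp q V (n + 1) (Function.update u n σ) := by
  rw [tailExp, sum_prod_resample q n hq]
  refine Finset.sum_congr rfl fun σ _ => ?_
  congr 1
  refine Finset.sum_congr rfl fun s _ => ?_
  congr 2
  funext i
  rcases lt_trichotomy i n with h | h | h
  · have h' : i.val < n.val := h
    simp [h', Nat.lt_succ_of_lt h', Function.update_of_ne h.ne]
  · subst h
    simp
  · have h' : n.val < i.val := h
    rw [if_neg (by omega), if_neg (by omega), Function.update_of_ne h.ne']

/-- A backward recursion computes the expectation under a product distribution. -/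
theorem sum_prod_eq_of_backward (hq : ∀ i, ∑ σ, q i σ = 1) (H : ℕ → (∀ i, T i) → ℝ)
    (hN : ∀ u, H N u = V u)
    (hstep : ∀ (n : Fin N) u, H n u = ∑ σ, q n σ * H (n + 1) (Function.update u n σ))
    (u : ∀ i, T i) : ∑ s : ∀ i, T i, (∏ i, q i (s i)) * V s = H 0 u := by
  -- Downward induction: k is the number of components still to be drawn.
  have key : ∀ k, k ≤ N → ∀ u, tailExp q V (N - k) u = H (N - k) u := by
    intro k
    induction k with
    | zero => intro _ u; simp [tailExp_last q V hq, hN]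
    | succ k ih =>
      intro hk u
      have h1 : N - (k + 1) + 1 = N - k := by omega
      have hs := hstep ⟨N - (k + 1), by omega⟩ u
      have ht := tailExp_step q V ⟨N - (k + 1), by omega⟩ (hq _) u
      simp only [h1] at hs ht
      rw [hs, ht]
      exact Finset.sum_congr rfl fun σ _ => by rw [ih (by omega)]
  have h := key N le_rfl u
  rwa [Nat.sub_self, tailExp_zero] at h

end Tail

end Marginals

/-! ### Bounds for the objectives -/

namespace RFMDP

section Objectives

variable {ι : Type} [Fintype ι] [DecidableEq ι] {S : ι → Type} [∀ i, Fintype (S i)] {A Φ : Type}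
  (R : RFMDP S A Φ) (π : (∀ i, S i) → A)

theorem le_value (p : Φ → stdSimplex ℝ (∀ i, S i)) (V : (∀ i, S i) → ℝ)
    (hV : ∀ s, V s ≤ R.r (R.φ s (π s)) + R.γ * ∑ s', p (R.φ s (π s)) s' * V s') :
    ∑ s, productDistribution R.q s * V s ≤ R.value π p :=
  le_expectedTotalReward R.γ_pos R.γ_lt_one _ _ _ V Set.univ (fun _ _ => trivial)
    (fun _ _ _ _ => trivial) fun s _ => hV s

theorem value_le (p : Φ → stdSimplex ℝ (∀ i, S i)) (V : (∀ i, S i) → ℝ)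
    (hV : ∀ s, R.r (R.φ s (π s)) + R.γ * ∑ s', p (R.φ s (π s)) s' * V s' ≤ V s) :
    R.value π p ≤ ∑ s, productDistribution R.q s * V s :=
  expectedTotalReward_le R.γ_pos R.γ_lt_one _ _ _ V Set.univ (fun _ _ => trivial)
    (fun _ _ _ _ => trivial) fun s _ => hV s

/-- The constant -C/(1-γ) is a subsolution for every kernel. Without a lower bound the real infimum
would take the default value 0. -/
theorem bddBelow_value : BddBelow (Set.range (R.value π)) := by
  obtain ⟨C, hC⟩ := exists_abs_le fun s => R.r (R.φ s (π s))
  refine ⟨-C / (1 - R.γ), ?_⟩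
  rintro _ ⟨p, rfl⟩
  rw [← simplex_sum_const (productDistribution R.q) (-C / (1 - R.γ))]
  refine R.le_value π p _ fun s => ?_
  rw [simplex_sum_const]
  have h1 := (abs_le.1 (hC s)).1
  have h2 : 0 < 1 - R.γ := sub_pos.2 R.γ_lt_one
  have h3 : -C / (1 - R.γ) = -C + R.γ * (-C / (1 - R.γ)) := by
    field_simp
    ring
  linarith

theorem bddBelow_range_value (s : Set (Φ → stdSimplex ℝ (∀ i, S i))) :
    BddBelow (Set.range fun p : s => R.value π p) :=
  (R.bddBelow_value π).mono (by rintro _ ⟨p, rfl⟩; exact ⟨p, rfl⟩)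

variable {R π} in
theorem NF_le {p : Φ → stdSimplex ℝ (∀ i, S i)} (hp : p ∈ R.nonFactoredSet) :
    R.NF π ≤ R.value π p :=
  ciInf_le (R.bddBelow_range_value π R.nonFactoredSet) ⟨p, hp⟩

variable {R π} in
theorem F_le {p : Φ → stdSimplex ℝ (∀ i, S i)} (hp : p ∈ R.factoredSet) :
    R.F π ≤ R.value π p :=
  ciInf_le (R.bddBelow_range_value π R.factoredSet) ⟨p, hp⟩

/-- Kernels are functions of the feature, so one product is chosen per feature value; off the range
of `φ`, where ambiguity sets may be empty, any distribution serves. -/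
theorem factoredSet_nonempty : R.factoredSet.Nonempty := by
  classical
  have h : ∀ f, ∃ ρ : stdSimplex ℝ (∀ i, S i), ∀ s a, R.φ s a = f →
      ∃ pm : ∀ i, S i → ℝ, (∀ i, pm i ∈ R.P i f) ∧ ∀ s' : ∀ i, S i, ρ s' = ∏ i, pm i (s' i) := by
    intro f
    by_cases hf : ∃ s a, R.φ s a = f
    · obtain ⟨s, a, rfl⟩ := hf
      choose d hd using fun i => R.P_nonempty i s a
      exact ⟨productDistribution fun i => ⟨d i, R.P_subset i _ (hd i)⟩, fun _ _ _ =>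
        ⟨d, hd, fun _ => rfl⟩⟩
    · exact ⟨productDistribution R.q, fun s a h => (hf ⟨s, a, h⟩).elim⟩
  choose p hp using h
  exact ⟨p, fun s a => hp _ s a rfl⟩

variable {R} in
/-- The factors of a factored kernel are its marginals. -/
theorem marg_eq_of_factored {f : Φ} {ρ : stdSimplex ℝ (∀ i, S i)} {pm : ∀ i, S i → ℝ}
    (hpm : ∀ i, pm i ∈ R.P i f) (h : ∀ s' : ∀ i, S i, ρ s' = ∏ i, pm i (s' i)) (i : ι) :
    marg ρ i = pm i := by
  have : ρ = productDistribution fun i => ⟨pm i, R.P_subset i f (hpm i)⟩ :=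
    Subtype.ext (funext h)
  rw [this, marg_productDistribution]

theorem factoredSet_subset_nonFactoredSet : R.factoredSet ⊆ R.nonFactoredSet := by
  intro p hp s a i
  obtain ⟨pm, h1, h2⟩ := hp s a
  rw [marg_eq_of_factored h1 h2]
  exact h1 i

theorem nonFactoredSet_nonempty : R.nonFactoredSet.Nonempty :=
  R.factoredSet_nonempty.mono R.factoredSet_subset_nonFactoredSet

variable {R π} in
-- Nonemptiness is essential here, as a real infimum over an empty family is 0.
theorem le_NF {v : ℝ} (h : ∀ p ∈ R.nonFactoredSet, v ≤ R.value π p) : v ≤ R.NF π := by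
  have : Nonempty R.nonFactoredSet := R.nonFactoredSet_nonempty.to_subtype
  exact le_ciInf fun p => h p p.2

variable {R π} in
theorem le_F {v : ℝ} (h : ∀ p ∈ R.factoredSet, v ≤ R.value π p) : v ≤ R.F π := by
  have : Nonempty R.factoredSet := R.factoredSet_nonempty.to_subtype
  exact le_ciInf fun p => h p p.2

end Objectives

end RFMDP

/-! ### The Bellman equation of the lift -/

namespace RFMDP

section LiftBounds

set_option linter.unusedSectionVars false

variable {N : ℕ} [NeZero N] {S : Fin N → Type} [∀ n, Fintype (S n)] {A : Type} [Fintype A]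
  {Φ : Type} (R : RFMDP S A Φ) (s₀ : ∀ n, S n) (a₀ : A)

/-- The feature that governs the transition of the lift out of `x` under the action `b`. -/
def activeFeature (x : LiftState S A) (b : A) : Φ :=
  if LiftState.n x = 0 then R.φ (LiftState.u x) b else R.φ (LiftState.m x) (LiftState.a x)

theorem exists_activeFeature_eq (x : LiftState S A) (b : A) :
    ∃ s a, R.activeFeature x b = R.φ s a := by
  unfold activeFeature
  split_ifs
  exacts [⟨_, _, rfl⟩, ⟨_, _, rfl⟩]

/-- The successor of `x` under the action `b` if the active sub-state moves to `σ`. -/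
def liftNext (x : LiftState S A) (b : A) (σ : S (LiftState.n x)) : LiftState S A :=
  LiftState.mk (Function.update (LiftState.u x) (LiftState.n x) σ)
    (if LiftState.n x + 1 = 0 then s₀ else if LiftState.n x = 0 then LiftState.u x
      else LiftState.m x)
    (if LiftState.n x + 1 = 0 then a₀ else if LiftState.n x = 0 then b else LiftState.a x)
    (LiftState.n x + 1)

theorem updP_active (x : LiftState S A) (b : A) :
    R.updP (LiftState.n x) ((R.lift s₀ a₀).φ x b) = R.P (LiftState.n x) (R.activeFeature x b) := by
  unfold updP activeFeature lift
  simp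

/-- All successors of a lifted state are determined by the new value of the active sub-state. -/
theorem eq_liftNext_of_ne_zero {x : LiftState S A} {b : A} {ρ : stdSimplex ℝ (LiftState S A)}
    (hρ : ∀ i, marg ρ i ∈ R.liftP s₀ a₀ i ((R.lift s₀ a₀).φ x b)) {y : LiftState S A}
    (hy : ρ y ≠ 0) : y = liftNext s₀ a₀ x b (y (.upd (LiftState.n x))) := by
  funext i
  have h := hρ i
  match i with
  | .upd k =>
    by_cases hk : k = LiftState.n x
    · subst hk
      exact (Function.update_self (LiftState.n x) _ (LiftState.u x)).symm
    · have h' : marg ρ (.upd k) ∈ R.updP k ((R.lift s₀ a₀).φ x b) := h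
      unfold updP at h'
      rw [if_neg (fun e => hk e.symm)] at h'
      refine (apply_eq_of_marg_eq_pointMass (i := LiftIdx.upd k) h' hy).trans ?_
      exact (Function.update_of_ne hk _ (LiftState.u x)).symm
  | .mem k =>
    refine (apply_eq_of_marg_eq_pointMass (i := LiftIdx.mem k) h hy).trans ?_
    have e : ∀ (c d : Prop) [Decidable c] [Decidable d] (f g h : ∀ n, S n),
        (if c then f k else if d then g k else h k) = (if c then f else if d then g else h) k := by
      intros
      split_ifs <;> rfl
    exact e _ _ _ _ _
  | .act => exact apply_eq_of_marg_eq_pointMass (i := LiftIdx.act) h hy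
  | .timer => exact apply_eq_of_marg_eq_pointMass (i := LiftIdx.timer) h hy

/-- Only one sub-state moves randomly per lifted step, so a lifted transition is determined by a
single marginal: correlations between sub-states have no room. -/
theorem sum_lift_step {x : LiftState S A} {b : A} {ρ : stdSimplex ℝ (LiftState S A)}
    (hρ : ∀ i, marg ρ i ∈ R.liftP s₀ a₀ i ((R.lift s₀ a₀).φ x b)) (W : LiftState S A → ℝ) :
    ∑ y, ρ y * W y = ∑ σ : S (LiftState.n x),
      marg ρ (.upd (LiftState.n x)) σ * W (liftNext s₀ a₀ x b σ) := by
  refine Eq.trans ?_ (sum_mul_comp_eq_sum_marg ρ (.upd (LiftState.n x))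
    fun σ => W (liftNext s₀ a₀ x b σ))
  refine Finset.sum_congr rfl fun y _ => ?_
  by_cases hy : ρ y = 0
  · rw [hy, zero_mul, zero_mul]
  · congr 2
    exact R.eq_liftNext_of_ne_zero s₀ a₀ hρ hy

/-- Every admissible distribution of the active sub-state is realised by a lifted kernel. -/
theorem exists_lift_transition (x : LiftState S A) (b : A) {μ : S (LiftState.n x) → ℝ}
    (hμ : μ ∈ R.P (LiftState.n x) (R.activeFeature x b)) :
    ∃ ρ : stdSimplex ℝ (LiftState S A),
      (∀ i, marg ρ i ∈ R.liftP s₀ a₀ i ((R.lift s₀ a₀).φ x b)) ∧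
        marg ρ (.upd (LiftState.n x)) = μ := by
  choose d hd using fun i => (R.lift s₀ a₀).P_nonempty i x b
  let μ' : stdSimplex ℝ (LiftSub S A (.upd (LiftState.n x))) := ⟨μ, R.P_subset _ _ hμ⟩
  -- All other marginals are arbitrary admissible ones; only the active component is prescribed.
  let d' : ∀ i, stdSimplex ℝ (LiftSub S A i) := Function.update
    (fun i => ⟨d i, (R.lift s₀ a₀).P_subset i _ (hd i)⟩) (.upd (LiftState.n x)) μ'
  have h0 : d' (.upd (LiftState.n x)) = μ' := Function.update_self _ _ _
  have h1 : (d' (.upd (LiftState.n x))).1 = μ := by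
    rw [h0]
  refine ⟨productDistribution d', fun i => ?_, ?_⟩
  · rw [marg_productDistribution]
    by_cases hi : i = .upd (LiftState.n x)
    · subst hi
      rw [h1]
      change μ ∈ R.updP (LiftState.n x) ((R.lift s₀ a₀).φ x b)
      rw [updP_active]
      exact hμ
    · simp only [d', Function.update_of_ne hi]
      exact hd i
  · rw [marg_productDistribution, h1]

/-- The states of the lift that are consistent with the timer. -/
def liftReachable : Set (LiftState S A) :=
  {x | LiftState.n x = 0 → LiftState.m x = s₀ ∧ LiftState.a x = a₀}

theorem liftNext_mem_liftReachable (x : LiftState S A) (b : A) (σ : S (LiftState.n x)) :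
    liftNext s₀ a₀ x b σ ∈ liftReachable s₀ a₀ := by
  intro h
  have h' : LiftState.n x + 1 = 0 := h
  constructor
  · funext k
    change (if LiftState.n x + 1 = 0 then s₀ else _) k = _
    rw [if_pos h']
  · change (if LiftState.n x + 1 = 0 then a₀ else _) = _
    rw [if_pos h']

theorem mem_liftReachable_of_ne_zero {x : LiftState S A} {b : A} {ρ : stdSimplex ℝ (LiftState S A)}
    (hρ : ∀ i, marg ρ i ∈ R.liftP s₀ a₀ i ((R.lift s₀ a₀).φ x b)) {y : LiftState S A}
    (hy : ρ y ≠ 0) : y ∈ liftReachable s₀ a₀ := by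
  rw [R.eq_liftNext_of_ne_zero s₀ a₀ hρ hy]
  exact liftNext_mem_liftReachable s₀ a₀ x b _

theorem initial_eq_mk {x : LiftState S A} (hx : productDistribution (R.lift s₀ a₀).q x ≠ 0) :
    x = LiftState.mk (LiftState.u x) s₀ a₀ 0 := by
  have h : ∀ i, (R.liftq s₀ a₀ i).1 (x i) ≠ 0 := fun i hi => hx
    (Finset.prod_eq_zero (f := fun i => R.liftq s₀ a₀ i (x i)) (Finset.mem_univ i) hi)
  funext i
  have hi := h i
  match i with
  | .upd k => rfl
  | .mem k => exact of_not_not fun hne => hi (if_neg hne)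
  | .act => exact of_not_not fun hne => hi (if_neg hne)
  | .timer => exact of_not_not fun hne => hi (if_neg hne)

theorem initial_mem_liftReachable {x : LiftState S A}
    (hx : productDistribution (R.lift s₀ a₀).q x ≠ 0) : x ∈ liftReachable s₀ a₀ := by
  rw [R.initial_eq_mk s₀ a₀ hx]
  exact fun _ => ⟨rfl, rfl⟩

/-- The update block of the initial state is distributed as the initial state of `R`. -/
theorem sum_initial_lift (V : (∀ n, S n) → ℝ) :
    ∑ x, productDistribution (R.lift s₀ a₀).q x * V (LiftState.u x) =
      ∑ u, productDistribution R.q u * V u := by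
  classical
  have hinj : Function.Injective fun u : ∀ n, S n => LiftState.mk u s₀ a₀ 0 := fun u v h => by
    have := congrArg LiftState.u h
    exact this
  symm
  refine Finset.sum_of_injOn (fun u => LiftState.mk u s₀ a₀ 0) hinj.injOn (by simp) ?_ ?_
  · intro x _ hx
    by_cases h0 : productDistribution (R.lift s₀ a₀).q x = 0
    · rw [h0, zero_mul]
    · exact (hx ⟨LiftState.u x, by simp, (R.initial_eq_mk s₀ a₀ h0).symm⟩).elim
  · intro u _
    congr 1
    let e : LiftIdx N ≃ (Fin N ⊕ Fin N) ⊕ (Unit ⊕ Unit) :=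
      { toFun := fun
          | .upd k => .inl (.inl k)
          | .mem k => .inl (.inr k)
          | .act => .inr (.inl ())
          | .timer => .inr (.inr ())
        invFun := fun
          | .inl (.inl k) => .upd k
          | .inl (.inr k) => .mem k
          | .inr (.inl _) => .act
          | .inr (.inr _) => .timer
        left_inv := by rintro (_ | _ | _ | _) <;> rfl
        right_inv := by rintro ((_ | _) | (_ | _)) <;> rfl }
    change ∏ k, R.q k (u k) = ∏ i, R.liftq s₀ a₀ i (LiftState.mk u s₀ a₀ 0 i)
    rw [← Equiv.prod_comp e.symm, Fintype.prod_sum_type, Fintype.prod_sum_type,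
      Fintype.prod_sum_type]
    have hm : ∀ k, R.liftq s₀ a₀ (.mem k) (LiftState.mk u s₀ a₀ 0 (.mem k)) = 1 :=
      fun k => if_pos rfl
    have ha : R.liftq s₀ a₀ .act (LiftState.mk u s₀ a₀ 0 .act) = 1 := if_pos rfl
    have ht : R.liftq s₀ a₀ .timer (LiftState.mk u s₀ a₀ 0 .timer) = 1 := if_pos rfl
    change _ = (∏ k, R.q k (u k)) *
      (∏ k, R.liftq s₀ a₀ (.mem k) (LiftState.mk u s₀ a₀ 0 (.mem k))) *
      ((∏ _ : Unit, R.liftq s₀ a₀ .act (LiftState.mk u s₀ a₀ 0 .act)) *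
        ∏ _ : Unit, R.liftq s₀ a₀ .timer (LiftState.mk u s₀ a₀ 0 .timer))
    simp only [hm, ha, ht, Finset.prod_const_one, mul_one]

/-- The value function of the lift assembled from a value function `V` of `R` and its
intermediate versions `G`. -/
def liftValue (V : (∀ n, S n) → ℝ) (G : ℕ → (∀ n, S n) → Φ → ℝ) (x : LiftState S A) : ℝ :=
  if LiftState.n x = 0 then V (LiftState.u x)
  -- `G` is measured at the start of the next cycle, hence the discount over the remaining lifted
  -- steps.
  else (R.lift s₀ a₀).γ ^ (N - (LiftState.n x).val) *
    G (LiftState.n x) (LiftState.u x) (R.φ (LiftState.m x) (LiftState.a x))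

theorem lift_γ_pow : (R.lift s₀ a₀).γ ^ N = R.γ := by
  change (R.γ ^ (1 / (N : ℝ))) ^ N = R.γ
  rw [← Real.rpow_natCast, ← Real.rpow_mul R.γ_pos.le, one_div,
    inv_mul_cancel₀ (Nat.cast_ne_zero.2 (NeZero.ne N)), Real.rpow_one]

theorem fin_val_add_one (n : Fin N) : (n + 1).val = (n.val + 1) % N := by
  rw [Fin.val_add, Fin.coe_ofNat_eq_mod, Nat.add_mod_mod]

theorem fin_val_add_one_of_ne {n : Fin N} (h : n + 1 ≠ 0) : (n + 1).val = n.val + 1 := by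
  have hn := n.isLt
  rw [fin_val_add_one]
  refine Nat.mod_eq_of_lt (lt_of_le_of_ne hn fun hN => h (Fin.ext ?_))
  rw [fin_val_add_one, show n.val + 1 = N from hN, Nat.mod_self]
  rfl

theorem fin_val_add_one_eq_of_eq {n : Fin N} (h : n + 1 = 0) : n.val + 1 = N := by
  by_contra hne
  have hn := n.isLt
  have h1 := congrArg Fin.val h
  rw [fin_val_add_one, Nat.mod_eq_of_lt (by omega)] at h1
  simp at h1

/-- The value of the successor, in terms of `G` or, at the end of the cycle, of `V`. -/
theorem liftValue_liftNext (V : (∀ n, S n) → ℝ) (G : ℕ → (∀ n, S n) → Φ → ℝ) (x : LiftState S A)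
    (b : A) (σ : S (LiftState.n x)) :
    (R.liftValue s₀ a₀ V G (liftNext s₀ a₀ x b σ) =
      (R.lift s₀ a₀).γ ^ (N - (LiftState.n x).val - 1) * G ((LiftState.n x).val + 1)
        (Function.update (LiftState.u x) (LiftState.n x) σ) (R.activeFeature x b)) ∨
    ((LiftState.n x).val + 1 = N ∧ R.liftValue s₀ a₀ V G (liftNext s₀ a₀ x b σ) =
      V (Function.update (LiftState.u x) (LiftState.n x) σ)) := by
  have hn : LiftState.n (liftNext s₀ a₀ x b σ) = LiftState.n x + 1 := rfl
  have hu : LiftState.u (liftNext s₀ a₀ x b σ) =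
    Function.update (LiftState.u x) (LiftState.n x) σ := rfl
  -- The wrap-around takes precedence over the first step, as in the lift: for N = 1 a single step
  -- is both.
  by_cases h : LiftState.n x + 1 = 0
  · right
    refine ⟨fin_val_add_one_eq_of_eq h, ?_⟩
    rw [liftValue, hn, if_pos h, hu]
  · left
    have hm : LiftState.m (liftNext s₀ a₀ x b σ) =
        if LiftState.n x = 0 then LiftState.u x else LiftState.m x := by
      change (if LiftState.n x + 1 = 0 then s₀ else _) = _
      rw [if_neg h]
    have ha : LiftState.a (liftNext s₀ a₀ x b σ) =
        if LiftState.n x = 0 then b else LiftState.a x := by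
      change (if LiftState.n x + 1 = 0 then a₀ else _) = _
      rw [if_neg h]
    rw [liftValue, hn, if_neg h, hu, hm, ha, fin_val_add_one_of_ne h, Nat.sub_sub]
    congr 2
    unfold activeFeature
    split_ifs <;> rfl

variable {R s₀ a₀} {π : (∀ n, S n) → A} {πl : LiftState S A → A}

theorem eq_mk_of_mem_liftReachable {x : LiftState S A} (hx : x ∈ liftReachable s₀ a₀)
    (h : LiftState.n x = 0) : x = LiftState.mk (LiftState.u x) s₀ a₀ 0 := by
  funext i
  match i with
  | .upd k => rfl
  | .mem k => exact congrFun (hx h).1 k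
  | .act => exact (hx h).2
  | .timer => exact h

/-- On consistent states the Bellman equation of the lift reads as an equation for `V` at the
beginning and for `G` within a cycle. -/
theorem liftValue_cases (hπl : πl ∈ liftedPolicies s₀ a₀ π) {x : LiftState S A}
    (hx : x ∈ liftReachable s₀ a₀) :
    (LiftState.n x = 0 ∧ R.activeFeature x (πl x) = R.φ (LiftState.u x) (π (LiftState.u x)) ∧
      (R.lift s₀ a₀).r ((R.lift s₀ a₀).φ x (πl x)) =
        R.r (R.φ (LiftState.u x) (π (LiftState.u x)))) ∨
    (LiftState.n x ≠ 0 ∧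
      R.activeFeature x (πl x) = R.φ (LiftState.m x) (LiftState.a x) ∧
      (R.lift s₀ a₀).r ((R.lift s₀ a₀).φ x (πl x)) = 0) := by
  by_cases h : LiftState.n x = 0
  · left
    have hpi : πl x = π (LiftState.u x) := by
      conv_lhs => rw [eq_mk_of_mem_liftReachable hx h]
      exact hπl _
    refine ⟨h, ?_, ?_⟩
    · rw [activeFeature, if_pos h, hpi]
    · rw [hpi]
      exact if_pos ⟨(hx h).1, (hx h).2, h⟩
  · right
    refine ⟨h, ?_, ?_⟩
    · rw [activeFeature, if_neg h]
    · exact if_neg fun h' => h h'.2.2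

/-- Lower bounds on the lifted objective from subsolutions. -/
theorem le_L (hπl : πl ∈ liftedPolicies s₀ a₀ π) (V : (∀ n, S n) → ℝ)
    (G : ℕ → (∀ n, S n) → Φ → ℝ)
    (h0 : ∀ u, V u ≤ R.r (R.φ u (π u)) + R.γ * G 0 u (R.φ u (π u)))
    (hN : ∀ u s a, G N u (R.φ s a) ≤ V u)
    (hstep : ∀ (n : Fin N) s a, ∀ p ∈ R.P n (R.φ s a), ∀ u, G n u (R.φ s a) ≤
      ∑ σ, p σ * G (n + 1) (Function.update u n σ) (R.φ s a)) :
    ∑ u, productDistribution R.q u * V u ≤ R.L s₀ a₀ πl := by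
  refine le_NF fun p hp => ?_
  rw [← R.sum_initial_lift s₀ a₀]
  have hW : ∑ x, productDistribution (R.lift s₀ a₀).q x * R.liftValue s₀ a₀ V G x ≤
      (R.lift s₀ a₀).value πl p := by
    refine le_expectedTotalReward (R.lift s₀ a₀).γ_pos (R.lift s₀ a₀).γ_lt_one _ _ _ _
      (liftReachable s₀ a₀) (fun x hx => R.initial_mem_liftReachable s₀ a₀ hx)
      (fun x _ y hy => R.mem_liftReachable_of_ne_zero s₀ a₀ (hp x (πl x)) hy) fun x hx => ?_
    have hγ := (R.lift s₀ a₀).γ_pos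
    rw [R.sum_lift_step s₀ a₀ (hp x (πl x))]
    set μ := marg (p ((R.lift s₀ a₀).φ x (πl x))) (.upd (LiftState.n x)) with hμdef
    have hμ : μ ∈ R.P (LiftState.n x) (R.activeFeature x (πl x)) := by
      rw [← R.updP_active s₀ a₀]
      exact hp x (πl x) (.upd (LiftState.n x))
    obtain ⟨s, a, hsa⟩ := R.exists_activeFeature_eq x (πl x)
    have hnext : ∀ σ, (R.lift s₀ a₀).γ ^ (N - (LiftState.n x).val - 1) *
        G ((LiftState.n x).val + 1) (Function.update (LiftState.u x) (LiftState.n x) σ)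
          (R.activeFeature x (πl x)) ≤
        R.liftValue s₀ a₀ V G (liftNext s₀ a₀ x (πl x) σ) := by
      intro σ
      rcases R.liftValue_liftNext s₀ a₀ V G x (πl x) σ with h | ⟨h1, h2⟩
      · exact h.ge
      · rw [h2, h1, Nat.sub_sub, h1, Nat.sub_self, pow_zero, one_mul, hsa]
        exact hN _ _ _
    -- One drawing step of `G`, with one lifted discount factor split off. At n = 0 the left-hand
    -- factor is the full discount γ of `R`.
    have hsum : (R.lift s₀ a₀).γ ^ (N - (LiftState.n x).val) *
        G (LiftState.n x) (LiftState.u x) (R.activeFeature x (πl x)) ≤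
        (R.lift s₀ a₀).γ * ∑ σ, μ σ * R.liftValue s₀ a₀ V G (liftNext s₀ a₀ x (πl x) σ) := by
      have h1 := hstep (LiftState.n x) s a μ (hsa ▸ hμ) (LiftState.u x)
      rw [← hsa] at h1
      have h2 : N - (LiftState.n x).val = (N - (LiftState.n x).val - 1) + 1 := by
        have := (LiftState.n x).isLt
        omega
      rw [h2, pow_succ', mul_assoc]
      refine mul_le_mul_of_nonneg_left ?_ hγ.le
      refine (mul_le_mul_of_nonneg_left h1 (pow_nonneg hγ.le _)).trans ?_
      rw [Finset.mul_sum]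
      refine Finset.sum_le_sum fun σ _ => ?_
      rw [mul_left_comm]
      exact mul_le_mul_of_nonneg_left (hnext σ) ((R.P_subset _ _ hμ).1 σ)
    rcases liftValue_cases (R := R) hπl hx with ⟨hn, hf, hr⟩ | ⟨hn, hf, hr⟩
    · have hv : R.liftValue s₀ a₀ V G x = V (LiftState.u x) := if_pos hn
      rw [hv, hr]
      refine (h0 _).trans (add_le_add le_rfl (le_trans ?_ hsum))
      rw [hf, hn]
      simp only [Fin.val_zero, Nat.sub_zero, lift_γ_pow]
      exact le_rfl
    · rw [hr, zero_add]
      rw [hf] at hsum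
      have hv : R.liftValue s₀ a₀ V G x = _ := if_neg hn
      rw [hv]
      exact hsum
  refine le_trans (simplex_sum_le fun x hx => ?_) hW
  have := R.initial_eq_mk s₀ a₀ hx
  have hn : LiftState.n x = 0 := by rw [this]; rfl
  rw [liftValue, if_pos hn]

/-- Upper bounds on the lifted objective from supersolutions. -/
theorem L_le (hπl : πl ∈ liftedPolicies s₀ a₀ π) (V : (∀ n, S n) → ℝ)
    (G : ℕ → (∀ n, S n) → Φ → ℝ)
    (h0 : ∀ u, R.r (R.φ u (π u)) + R.γ * G 0 u (R.φ u (π u)) ≤ V u)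
    (hN : ∀ u s a, V u ≤ G N u (R.φ s a))
    (hstep : ∀ (n : Fin N) s a u, ∃ p ∈ R.P n (R.φ s a),
      ∑ σ, p σ * G (n + 1) (Function.update u n σ) (R.φ s a) ≤ G n u (R.φ s a)) :
    R.L s₀ a₀ πl ≤ ∑ u, productDistribution R.q u * V u := by
  have hex : ∀ (x : LiftState S A) (b : A), ∃ ρ : stdSimplex ℝ (LiftState S A),
      (∀ i, marg ρ i ∈ R.liftP s₀ a₀ i ((R.lift s₀ a₀).φ x b)) ∧
      ∑ σ : S (LiftState.n x), marg ρ (.upd (LiftState.n x)) σ * G ((LiftState.n x).val + 1)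
        (Function.update (LiftState.u x) (LiftState.n x) σ) (R.activeFeature x b) ≤
        G (LiftState.n x) (LiftState.u x) (R.activeFeature x b) := by
    intro x b
    obtain ⟨s, a, hsa⟩ := R.exists_activeFeature_eq x b
    obtain ⟨μ, hμ, h⟩ := hstep (LiftState.n x) s a (LiftState.u x)
    rw [← hsa] at hμ h
    obtain ⟨ρ, h1, h2⟩ := R.exists_lift_transition s₀ a₀ x b hμ
    refine ⟨ρ, h1, ?_⟩
    rw [h2]
    exact h
  choose ρ hρ hρG using hex
  -- The lifted feature contains the state and the action, so nature may choose a separate law at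
  -- each lifted state and adapt it to the draws made so far.
  let p : LiftFeature S A Φ → stdSimplex ℝ (LiftState S A) := fun f => ρ f.state f.action
  have hp : p ∈ (R.lift s₀ a₀).nonFactoredSet := fun x b i => hρ x b i
  refine (NF_le hp).trans ?_
  rw [← R.sum_initial_lift s₀ a₀]
  have hW : (R.lift s₀ a₀).value πl p ≤
      ∑ x, productDistribution (R.lift s₀ a₀).q x * R.liftValue s₀ a₀ V G x := by
    refine expectedTotalReward_le (R.lift s₀ a₀).γ_pos (R.lift s₀ a₀).γ_lt_one _ _ _ _
      (liftReachable s₀ a₀) (fun x hx => R.initial_mem_liftReachable s₀ a₀ hx)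
      (fun x _ y hy => R.mem_liftReachable_of_ne_zero s₀ a₀ (hp x (πl x)) hy) fun x hx => ?_
    have hγ := (R.lift s₀ a₀).γ_pos
    rw [R.sum_lift_step s₀ a₀ (hp x (πl x))]
    have h1 := hρG x (πl x)
    have hμ0 : ∀ σ : S (LiftState.n x), 0 ≤ marg (ρ x (πl x)) (.upd (LiftState.n x)) σ :=
      (marg_mem_stdSimplex (ρ x (πl x)) (.upd (LiftState.n x))).1
    obtain ⟨s, a, hsa⟩ := R.exists_activeFeature_eq x (πl x)
    change _ + _ * ∑ σ : S (LiftState.n x), marg (ρ x (πl x)) (.upd (LiftState.n x)) σ * _ ≤ _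
    have hnext : ∀ σ, R.liftValue s₀ a₀ V G (liftNext s₀ a₀ x (πl x) σ) ≤
        (R.lift s₀ a₀).γ ^ (N - (LiftState.n x).val - 1) *
        G ((LiftState.n x).val + 1) (Function.update (LiftState.u x) (LiftState.n x) σ)
          (R.activeFeature x (πl x)) := by
      intro σ
      rcases R.liftValue_liftNext s₀ a₀ V G x (πl x) σ with h | ⟨h1, h2⟩
      · exact h.le
      · rw [h2, h1, Nat.sub_sub, h1, Nat.sub_self, pow_zero, one_mul, hsa]
        exact hN _ _ _
    have hsum : (R.lift s₀ a₀).γ * ∑ σ : S (LiftState.n x),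
        marg (ρ x (πl x)) (.upd (LiftState.n x)) σ *
          R.liftValue s₀ a₀ V G (liftNext s₀ a₀ x (πl x) σ) ≤
        (R.lift s₀ a₀).γ ^ (N - (LiftState.n x).val) *
        G (LiftState.n x) (LiftState.u x) (R.activeFeature x (πl x)) := by
      have h2 : N - (LiftState.n x).val = (N - (LiftState.n x).val - 1) + 1 := by
        have := (LiftState.n x).isLt
        omega
      rw [h2, pow_succ', mul_assoc]
      refine mul_le_mul_of_nonneg_left ?_ hγ.le
      refine le_trans ?_ (mul_le_mul_of_nonneg_left h1 (pow_nonneg hγ.le _))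
      rw [Finset.mul_sum]
      refine Finset.sum_le_sum fun σ _ => ?_
      rw [mul_left_comm]
      exact mul_le_mul_of_nonneg_left (hnext σ) (hμ0 σ)
    rcases liftValue_cases (R := R) hπl hx with ⟨hn, hf, hr⟩ | ⟨hn, hf, hr⟩
    · have hv : R.liftValue s₀ a₀ V G x = V (LiftState.u x) := if_pos hn
      rw [hv, hr]
      refine le_trans (add_le_add le_rfl ?_) (h0 _)
      refine hsum.trans ?_
      rw [hf, hn]
      simp only [Fin.val_zero, Nat.sub_zero, lift_γ_pow]
      exact le_rfl
    · rw [hr, zero_add]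
      rw [hf] at hsum
      have hv : R.liftValue s₀ a₀ V G x = _ := if_neg hn
      rw [hv]
      exact hsum
  refine hW.trans (simplex_sum_le fun x hx => ?_)
  have := R.initial_eq_mk s₀ a₀ hx
  have hn : LiftState.n x = 0 := by rw [this]; rfl
  rw [liftValue, if_pos hn]

end LiftBounds

end RFMDP

/-! ### The lifted objective lies between the non-factored and the factored one -/

section LowerExpectation

variable {X : Type} [Fintype X]

/-- The infimum of the expectations of `V` over a set of distributions. -/
def lowerExp (C : Set (stdSimplex ℝ X)) (V : X → ℝ) : ℝ := ⨅ ρ : C, ∑ x, ρ.1 x * V x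

theorem lowerExp_le {C : Set (stdSimplex ℝ X)} {ρ : stdSimplex ℝ X} (hρ : ρ ∈ C) (V : X → ℝ) :
    lowerExp C V ≤ ∑ x, ρ x * V x := by
  obtain ⟨B, hB⟩ := exists_abs_le V
  refine ciInf_le (f := fun ρ : C => ∑ x, ρ.1 x * V x) ⟨-B, ?_⟩ ⟨ρ, hρ⟩
  rintro _ ⟨ρ', rfl⟩
  exact (abs_le.1 (abs_simplex_sum_le hB)).1

/-- Near-minimisers are used throughout, so no compactness argument is required. -/
theorem exists_lt_lowerExp_add {C : Set (stdSimplex ℝ X)} (hC : C.Nonempty) (V : X → ℝ) {ε : ℝ}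
    (hε : 0 < ε) : ∃ ρ ∈ C, ∑ x, ρ x * V x < lowerExp C V + ε := by
  have : Nonempty C := hC.to_subtype
  obtain ⟨ρ, hρ⟩ := exists_lt_of_ciInf_lt (f := fun ρ : C => ∑ x, ρ.1 x * V x)
    (lt_add_of_pos_right (lowerExp C V) hε)
  exact ⟨ρ, ρ.2, hρ⟩

/-- Lower expectations are 1-Lipschitz in the sup norm, which makes the robust Bellman operator a
γ-contraction. -/
theorem lowerExp_le_add_dist {C : Set (stdSimplex ℝ X)} (hC : C.Nonempty) (V W : X → ℝ) :
    lowerExp C V ≤ lowerExp C W + dist V W := by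
  refine le_of_forall_pos_le_add fun ε hε => ?_
  obtain ⟨ρ, hρ, h⟩ := exists_lt_lowerExp_add hC W hε
  have h1 := lowerExp_le hρ V
  have h2 : ∑ x, ρ x * V x ≤ ∑ x, ρ x * (W x + dist V W) := simplex_sum_le fun x _ => by
    have h3 := (le_abs_self _).trans (dist_le_pi_dist V W x)
    linarith
  simp only [mul_add, Finset.sum_add_distrib, simplex_sum_const] at h2
  linarith

end LowerExpectation

namespace RFMDP

/-! ### The robust Bellman equation of the non-factored model -/

section Robust

variable {ι : Type} [Fintype ι] [DecidableEq ι] {S : ι → Type} [∀ i, Fintype (S i)] {A Φ : Type}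
  (R : RFMDP S A Φ) (π : (∀ i, S i) → A)

/-- The distributions whose marginals lie in the marginal ambiguity sets. -/
def margSet (f : Φ) : Set (stdSimplex ℝ (∀ i, S i)) := {ρ | ∀ i, marg ρ i ∈ R.P i f}

theorem margSet_nonempty (s : ∀ i, S i) (a : A) : (R.margSet (R.φ s a)).Nonempty := by
  obtain ⟨p, hp⟩ := R.nonFactoredSet_nonempty
  exact ⟨p (R.φ s a), hp s a⟩

/-- The robust Bellman equation has a solution. -/
theorem exists_robust_value : ∃ V : (∀ i, S i) → ℝ, ∀ s,
    V s = R.r (R.φ s (π s)) + R.γ * lowerExp (R.margSet (R.φ s (π s))) V := by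
  let T : ((∀ i, S i) → ℝ) → ((∀ i, S i) → ℝ) := fun V s =>
    R.r (R.φ s (π s)) + R.γ * lowerExp (R.margSet (R.φ s (π s))) V
  have hT : ContractingWith ⟨R.γ, R.γ_pos.le⟩ T := by
    refine ⟨R.γ_lt_one, LipschitzWith.of_dist_le_mul fun V W => ?_⟩
    refine (dist_pi_le_iff (mul_nonneg R.γ_pos.le dist_nonneg)).2 fun s => ?_
    have h1 := lowerExp_le_add_dist (R.margSet_nonempty s (π s)) V W
    have h2 := lowerExp_le_add_dist (R.margSet_nonempty s (π s)) W V
    rw [dist_comm W V] at h2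
    have h3 : T V s - T W s = R.γ * (lowerExp (R.margSet (R.φ s (π s))) V -
        lowerExp (R.margSet (R.φ s (π s))) W) := by
      simp only [T]
      ring
    rw [Real.dist_eq, h3, abs_mul, abs_of_pos R.γ_pos]
    refine mul_le_mul_of_nonneg_left (abs_le.2 ⟨?_, ?_⟩) R.γ_pos.le <;> linarith
  exact ⟨hT.fixedPoint T, fun s => (congrFun hT.fixedPoint_isFixedPt s).symm⟩

/-- The non-factored objective is at most the value given by the robust Bellman equation. -/
theorem NF_le_robust_value {V : (∀ i, S i) → ℝ}
    (hV : ∀ s, V s = R.r (R.φ s (π s)) + R.γ * lowerExp (R.margSet (R.φ s (π s))) V) :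
    R.NF π ≤ ∑ s, productDistribution R.q s * V s := by
  refine le_of_forall_pos_le_add fun δ hδ => ?_
  have hγ := sub_pos.2 R.γ_lt_one
  -- The minimisation depends on the state only through its feature, so near-minimisers can be
  -- chosen per feature. The slack (1-γ)δ is what makes `V + δ` a supersolution.
  have hex : ∀ f, ∃ ρ : stdSimplex ℝ (∀ i, S i), ∀ s a, R.φ s a = f → ρ ∈ R.margSet f ∧
      ∑ s', ρ s' * V s' ≤ lowerExp (R.margSet f) V + (1 - R.γ) * δ := by
    intro f
    by_cases hf : ∃ s a, R.φ s a = f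
    · obtain ⟨s, a, rfl⟩ := hf
      obtain ⟨ρ, h1, h2⟩ := exists_lt_lowerExp_add (R.margSet_nonempty s a) V (mul_pos hγ hδ)
      exact ⟨ρ, fun _ _ _ => ⟨h1, h2.le⟩⟩
    · exact ⟨productDistribution R.q, fun s a h => (hf ⟨s, a, h⟩).elim⟩
  choose p hp using hex
  have hpm : p ∈ R.nonFactoredSet := fun s a => (hp _ s a rfl).1
  refine (NF_le hpm).trans ((R.value_le π p (fun s => V s + δ) fun s => ?_).trans_eq ?_)
  · have h1 := (hp _ s (π s) rfl).2
    have h2 := hV s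
    simp only [mul_add, Finset.sum_add_distrib, simplex_sum_const]
    have h3 := mul_le_mul_of_nonneg_left h1 R.γ_pos.le
    have h4 : R.γ * ((1 - R.γ) * δ) ≤ (1 - R.γ) * δ :=
      mul_le_of_le_one_left (mul_pos hγ hδ).le R.γ_lt_one.le
    linarith
  · simp only [mul_add, Finset.sum_add_distrib, simplex_sum_const]

end Robust

/-! ### Fixing the components one at a time -/

section Sandwich

variable {N : ℕ} {S : Fin N → Type} [∀ n, Fintype (S n)] {A Φ : Type} (R : RFMDP S A Φ)

/-- The distributions whose components `< n` are fixed at `u` and whose remaining marginals lie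
in the marginal ambiguity sets. -/
def partialSet (n : ℕ) (u : ∀ i, S i) (f : Φ) : Set (stdSimplex ℝ (∀ i, S i)) :=
  {ρ | ∀ i : Fin N, (i.val < n → marg ρ i = (pointMass (u i)).1) ∧
    (n ≤ i.val → marg ρ i ∈ R.P i f)}

theorem partialSet_zero (u : ∀ i, S i) (f : Φ) : R.partialSet 0 u f = R.margSet f := by
  ext ρ
  simp [partialSet, margSet]

theorem pointMass_mem_partialSet (u : ∀ i, S i) (f : Φ) : pointMass u ∈ R.partialSet N u f :=
  fun i => ⟨fun _ => marg_pointMass u i, fun h => absurd i.isLt (not_lt.2 h)⟩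

theorem partialSet_nonempty (n : ℕ) (u s : ∀ i, S i) (a : A) :
    (R.partialSet n u (R.φ s a)).Nonempty := by
  choose d hd using fun i => R.P_nonempty i s a
  refine ⟨productDistribution fun i => if i.val < n then pointMass (u i)
    else ⟨d i, R.P_subset i _ (hd i)⟩, fun i => ⟨fun h => ?_, fun h => ?_⟩⟩
  · rw [marg_productDistribution, if_pos h]
  · rw [marg_productDistribution, if_neg (not_lt.2 h)]
    exact hd i

/-- Draw component n from `p`, then continue with a law depending on the outcome. Components below n
stay fixed, component n gets marginal `p`, and later marginals are averages of admissible ones,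
hence admissible by convexity. -/
theorem mixture_mem_partialSet {n : Fin N} {u : ∀ i, S i} {f : Φ} {p : S n → ℝ}
    (hp : p ∈ R.P n f) {ρ : S n → stdSimplex ℝ (∀ i, S i)}
    (hρ : ∀ σ, ρ σ ∈ R.partialSet (n + 1) (Function.update u n σ) f) :
    mixture ⟨p, R.P_subset n f hp⟩ ρ ∈ R.partialSet n u f := by
  have hp1 := R.P_subset n f hp
  intro i
  rw [marg_mixture]
  change (_ → ∑ σ, p σ • _ = _) ∧ (_ → ∑ σ, p σ • _ ∈ _)
  refine ⟨fun h => ?_, fun h => ?_⟩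
  · have hne : i ≠ n := fun e => by subst e; exact lt_irrefl _ h
    have : ∀ σ, marg (ρ σ) i = (pointMass (u i)).1 := fun σ => by
      rw [(hρ σ i).1 (Nat.lt_succ_of_lt h), Function.update_of_ne hne]
    simp only [this, ← Finset.sum_smul]
    rw [hp1.2, one_smul]
  · rcases h.eq_or_lt with h | h
    · obtain rfl : n = i := Fin.ext h
      have : ∀ σ, marg (ρ σ) n = (pointMass σ).1 := fun σ => by
        rw [(hρ σ n).1 (Nat.lt_succ_self _), Function.update_self]
      simp only [this, sum_smul_pointMass]
      exact hp
    · exact (isPolyhedron_convex (R.P_polyhedral i f)).sum_mem (fun σ _ => hp1.1 σ) hp1.2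
        fun σ _ => (hρ σ i).2 h

variable [NeZero N] [Fintype A] {s₀ : ∀ n, S n} {a₀ : A} {π : (∀ n, S n) → A}
  {πl : LiftState S A → A}

/-- In mid-cycle, `G` lets nature choose the rest of the joint law at once. Drawing one component
and then choosing is no better for nature, since the outcomes can be glued by
`mixture_mem_partialSet`. -/
theorem NF_le_L (hπl : πl ∈ liftedPolicies s₀ a₀ π) : R.NF π ≤ R.L s₀ a₀ πl := by
  obtain ⟨V, hV⟩ := R.exists_robust_value π
  refine (R.NF_le_robust_value π hV).trans
    (le_L hπl V (fun n u f => lowerExp (R.partialSet n u f) V) (fun u => ?_) (fun u s a => ?_) ?_)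
  · rw [partialSet_zero]
    exact (hV u).le
  · exact (lowerExp_le (R.pointMass_mem_partialSet u _) V).trans_eq (sum_pointMass_mul u V)
  · intro n s a p hp u
    refine le_of_forall_pos_le_add fun ε hε => ?_
    -- A near-optimal continuation for each outcome σ of component n.
    choose ρ hρ hρV using fun σ => exists_lt_lowerExp_add
      (R.partialSet_nonempty (n + 1) (Function.update u n σ) s a) V hε
    refine (lowerExp_le (R.mixture_mem_partialSet hp hρ) V).trans ?_
    rw [sum_mixture_mul]
    refine (simplex_sum_le fun σ _ => (hρV σ).le).trans_eq ?_
    simp only [mul_add, Finset.sum_add_distrib, simplex_sum_const]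
    rfl

/-- Nature in the lift can play the marginals of a given factored kernel one after the other, which
reproduces its value exactly. -/
theorem L_le_F (hπl : πl ∈ liftedPolicies s₀ a₀ π) : R.L s₀ a₀ πl ≤ R.F π := by
  refine le_F fun p hp => ?_
  have hpm := R.factoredSet_subset_nonFactoredSet hp
  set V := chainValue (fun s => p (R.φ s (π s))) (fun s => R.r (R.φ s (π s))) R.γ with hVdef
  have hval : R.value π p = ∑ s, productDistribution R.q s * V s :=
    expectedTotalReward_eq R.γ_pos R.γ_lt_one _ _ _
  rw [hval]
  refine L_le hπl V (fun n u f => tailExp (fun i => marg (p f) i) V n u) (fun u => ?_)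
    (fun u s a => ?_) fun n s a u => ⟨marg (p (R.φ s a)) n, hpm s a n, ?_⟩
  · rw [tailExp_zero, hVdef, chainValue_bellman R.γ_pos R.γ_lt_one, ← hVdef]
    obtain ⟨pm, h1, h2⟩ := hp u (π u)
    simp only [h2, marg_eq_of_factored h1 h2]
    exact le_rfl
  · exact (tailExp_last _ _ (fun i => (marg_mem_stdSimplex _ i).2) u).ge
  · exact (tailExp_step _ V n (marg_mem_stdSimplex _ n).2 u).ge

end Sandwich

end RFMDP

/-! ### Instances with state-independent ambiguity -/

theorem isPolyhedron_stdSimplex (X : Type) [Fintype X] : IsPolyhedron (stdSimplex ℝ X) := by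
  classical
  let e := Fintype.equivFin (X ⊕ Bool)
  refine ⟨Fintype.card (X ⊕ Bool),
    fun k x => Sum.elim (fun z => if z = x then -1 else 0) (fun b => if b then 1 else -1)
      (e.symm k),
    fun k => Sum.elim (fun _ => 0) (fun b => if b then 1 else -1) (e.symm k), ?_⟩
  ext x
  simp only [stdSimplex, Set.mem_ofPred_eq, Pi.le_def, Matrix.mulVec, dotProduct]
  rw [← e.forall_congr_right]
  simp only [Equiv.symm_apply_apply, Sum.forall, Sum.elim_inl, Sum.elim_inr, ite_mul, one_mul,
    neg_mul, zero_mul, Finset.sum_ite_eq, Finset.mem_univ, if_true, Bool.forall_bool,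
    Bool.false_eq_true, if_false, Finset.sum_neg_distrib, neg_le_neg_iff, Left.neg_nonpos_iff]
  exact and_congr Iff.rfl ⟨fun h => ⟨h.ge, h.le⟩, fun h => le_antisymm h.2 h.1⟩

/-- The uniform distribution on two points. -/
def fairCoin : stdSimplex ℝ Bool :=
  ⟨fun _ => 1 / 2, fun _ => by norm_num, by norm_num [Fintype.sum_bool]⟩

/-- The marginal ambiguity sets that fix the sub-states in `D` to fair coins and leave the
distributions of all other sub-states unrestricted. -/
def coinSet {N : ℕ} (D : Finset (Fin N)) (i : Fin N) : Set (Bool → ℝ) :=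
  if i ∈ D then {fairCoin.1} else stdSimplex ℝ Bool

theorem coinSet_subset {N : ℕ} (D : Finset (Fin N)) (i : Fin N) :
    coinSet D i ⊆ stdSimplex ℝ Bool := by
  unfold coinSet
  split_ifs
  · exact Set.singleton_subset_iff.2 fairCoin.2
  · exact subset_rfl

theorem fairCoin_mem_coinSet {N : ℕ} (D : Finset (Fin N)) (i : Fin N) :
    fairCoin.1 ∈ coinSet D i := by
  unfold coinSet
  split_ifs
  · rfl
  · exact fairCoin.2

theorem eq_fairCoin_of_mem {N : ℕ} {D : Finset (Fin N)} {i : Fin N} (hi : i ∈ D) {p : Bool → ℝ}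
    (hp : p ∈ coinSet D i) : p = fun _ => 1 / 2 := by
  rw [coinSet, if_pos hi] at hp
  exact hp

theorem mem_coinSet_of_notMem {N : ℕ} {D : Finset (Fin N)} {i : Fin N} (hi : i ∉ D)
    (p : stdSimplex ℝ Bool) : p.1 ∈ coinSet D i := by
  rw [coinSet, if_neg hi]
  exact p.2

/-- The binary instance with reward `c(s)` that starts in the zero state and whose transitions
draw the sub-states according to `coinSet D`, whatever the current state and action. -/
def coinRFMDP {N : ℕ} (D : Finset (Fin N)) (c : (Fin N → Bool) → ℝ) (γ : ℝ) (hγ : 0 < γ)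
    (hγ1 : γ < 1) : BinaryRFMDP N (Finset.univ : Finset (Fin 1 → Bool)) N where
  φ s _ := s
  q _ := pointMass false
  P i _ := coinSet D i
  P_subset i _ := coinSet_subset D i
  P_polyhedral i _ := by
    unfold coinSet
    split_ifs
    · exact isPolyhedron_singleton _
    · exact isPolyhedron_stdSimplex Bool
  P_nonempty i _ _ := ⟨_, fairCoin_mem_coinSet D i⟩
  r := c
  γ := γ
  γ_pos := hγ
  γ_lt_one := hγ1

namespace coinRFMDP

variable {N : ℕ} {D : Finset (Fin N)} {c : (Fin N → Bool) → ℝ} {γ : ℝ} {hγ : 0 < γ} {hγ1 : γ < 1}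

theorem sum_initial (V : (Fin N → Bool) → ℝ) :
    ∑ u, productDistribution (coinRFMDP D c γ hγ hγ1).q u * V u = V fun _ => false := by
  rw [← simplex_sum_const (productDistribution (coinRFMDP D c γ hγ hγ1).q) (V fun _ => false)]
  refine Finset.sum_congr rfl fun u _ => ?_
  by_cases hu : productDistribution (coinRFMDP D c γ hγ hγ1).q u = 0
  · rw [hu, zero_mul, zero_mul]
  · congr 2
    funext i
    exact apply_eq_of_marg_eq_pointMass (marg_productDistribution _ i) hu

/-- An expected reward κ at every time from 1 onwards is worth γκ/(1-γ). -/
theorem discount_identity (hγ1 : γ < 1) (κ : ℝ) :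
    γ * (κ + γ * (1 - γ)⁻¹ * κ) = γ * (1 - γ)⁻¹ * κ := by
  have h : 1 - γ ≠ 0 := (sub_pos.2 hγ1).ne'
  field_simp
  ring

theorem sum_mul_add_const (ρ : stdSimplex ℝ (Fin N → Bool)) (a : ℝ) :
    ∑ s, ρ s * (c s + a) = ∑ s, ρ s * c s + a := by
  simp only [mul_add, Finset.sum_add_distrib, simplex_sum_const]

variable {π : (Fin N → Bool) → (Finset.univ : Finset (Fin 1 → Bool))} {κ : ℝ}

/-- Since the expected reward of the next state is at least κ from everywhere, `c u` plus the
constant γκ/(1-γ) is a subsolution. -/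
theorem le_value (p : (Fin N → Bool) → stdSimplex ℝ (Fin N → Bool))
    (h : ∀ u, κ ≤ ∑ s, p u s * c s) :
    c (fun _ => false) + γ * (1 - γ)⁻¹ * κ ≤ (coinRFMDP D c γ hγ hγ1).value π p := by
  rw [← sum_initial (D := D) (hγ := hγ) (hγ1 := hγ1) fun u => c u + γ * (1 - γ)⁻¹ * κ]
  refine RFMDP.le_value _ _ _ _ fun u => ?_
  rw [sum_mul_add_const]
  change _ ≤ c u + γ * (∑ s, p u s * c s + _)
  have h1 := mul_le_mul_of_nonneg_left (h u) hγ.le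
  have h2 := discount_identity hγ1 κ
  rw [mul_add] at h2 ⊢
  linarith

theorem value_le (p : (Fin N → Bool) → stdSimplex ℝ (Fin N → Bool))
    (h : ∀ u, ∑ s, p u s * c s ≤ κ) :
    (coinRFMDP D c γ hγ hγ1).value π p ≤ c (fun _ => false) + γ * (1 - γ)⁻¹ * κ := by
  rw [← sum_initial (D := D) (hγ := hγ) (hγ1 := hγ1) fun u => c u + γ * (1 - γ)⁻¹ * κ]
  refine RFMDP.value_le _ _ _ _ fun u => ?_
  rw [sum_mul_add_const]
  change c u + γ * (∑ s, p u s * c s + _) ≤ _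
  have h1 := mul_le_mul_of_nonneg_left (h u) hγ.le
  have h2 := discount_identity hγ1 κ
  rw [mul_add] at h2 ⊢
  linarith

theorem le_NF (h : ∀ ρ : stdSimplex ℝ (Fin N → Bool), (∀ i, marg ρ i ∈ coinSet D i) →
      κ ≤ ∑ s, ρ s * c s) :
    c (fun _ => false) + γ * (1 - γ)⁻¹ * κ ≤ (coinRFMDP D c γ hγ hγ1).NF π :=
  RFMDP.le_NF fun p hp => le_value p fun u => h _ (hp u (π u))

theorem NF_le (ρ : stdSimplex ℝ (Fin N → Bool)) (hρ : ∀ i, marg ρ i ∈ coinSet D i)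
    (h : ∑ s, ρ s * c s ≤ κ) :
    (coinRFMDP D c γ hγ hγ1).NF π ≤ c (fun _ => false) + γ * (1 - γ)⁻¹ * κ :=
  (RFMDP.NF_le (p := fun _ => ρ) fun _ _ => hρ).trans (value_le _ fun _ => h)

/-- Meant for rewards whose expectation is the same under every admissible product, so that nothing
is left to minimise. -/
theorem F_eq (h : ∀ pm : Fin N → Bool → ℝ, (∀ i, pm i ∈ coinSet D i) →
      ∑ s : Fin N → Bool, (∏ i, pm i (s i)) * c s = κ) :
    (coinRFMDP D c γ hγ hγ1).F π = c (fun _ => false) + γ * (1 - γ)⁻¹ * κ := by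
  have hv : ∀ p ∈ (coinRFMDP D c γ hγ hγ1).factoredSet, ∀ u, ∑ s, p u s * c s = κ := by
    intro p hp u
    obtain ⟨pm, h1, h2⟩ := hp u (π u)
    rw [← h pm h1]
    exact Finset.sum_congr rfl fun s _ => by rw [← h2 s]; rfl
  refine le_antisymm ?_ (RFMDP.le_F fun p hp => le_value p fun u => (hv p hp u).ge)
  obtain ⟨p, hp⟩ := (coinRFMDP D c γ hγ hγ1).factoredSet_nonempty
  exact (RFMDP.F_le hp).trans (value_le p fun u => (hv p hp u).le)

section Lift

variable [NeZero N] {s₀ : Fin N → Bool} {a₀ : (Finset.univ : Finset (Fin 1 → Bool))}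
  {πl : LiftState (fun _ : Fin N => Bool) (Finset.univ : Finset (Fin 1 → Bool)) →
    (Finset.univ : Finset (Fin 1 → Bool))}

/-- `H n u` bounds the expected next reward once the components below n are drawn; the added
constant accounts for all later cycles. -/
theorem le_L (hπl : πl ∈ liftedPolicies s₀ a₀ π) (H : ℕ → (Fin N → Bool) → ℝ)
    (h0 : ∀ u, κ ≤ H 0 u) (hN : ∀ u, H N u ≤ c u)
    (hstep : ∀ n : Fin N, ∀ p ∈ coinSet D n, ∀ u,
      H n u ≤ ∑ σ, p σ * H (n + 1) (Function.update u n σ)) :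
    c (fun _ => false) + γ * (1 - γ)⁻¹ * κ ≤ (coinRFMDP D c γ hγ hγ1).L s₀ a₀ πl := by
  rw [← sum_initial (D := D) (hγ := hγ) (hγ1 := hγ1) fun u => c u + γ * (1 - γ)⁻¹ * κ]
  refine RFMDP.le_L hπl _ (fun n u _ => H n u + γ * (1 - γ)⁻¹ * κ) (fun u => ?_)
    (fun u _ _ => add_le_add (hN u) le_rfl) fun n s a p hp u => ?_
  · change _ ≤ c u + γ * (H 0 u + _)
    have h1 := mul_le_mul_of_nonneg_left (h0 u) hγ.le
    have h2 := discount_identity hγ1 κ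
    rw [mul_add] at h2 ⊢
    linarith
  · have h1 := hstep n p hp u
    simp only [mul_add, Finset.sum_add_distrib, ← Finset.sum_mul]
    rw [(coinSet_subset D n hp).2, one_mul]
    linarith

theorem L_le (hπl : πl ∈ liftedPolicies s₀ a₀ π) (H : ℕ → (Fin N → Bool) → ℝ)
    (h0 : ∀ u, H 0 u ≤ κ) (hN : ∀ u, c u ≤ H N u)
    (hstep : ∀ (n : Fin N) u, ∃ p ∈ coinSet D n,
      ∑ σ, p σ * H (n + 1) (Function.update u n σ) ≤ H n u) :
    (coinRFMDP D c γ hγ hγ1).L s₀ a₀ πl ≤ c (fun _ => false) + γ * (1 - γ)⁻¹ * κ := by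
  rw [← sum_initial (D := D) (hγ := hγ) (hγ1 := hγ1) fun u => c u + γ * (1 - γ)⁻¹ * κ]
  refine RFMDP.L_le hπl _ (fun n u _ => H n u + γ * (1 - γ)⁻¹ * κ) (fun u => ?_)
    (fun u _ _ => add_le_add (hN u) le_rfl) fun n s a u => ?_
  · change c u + γ * (H 0 u + _) ≤ _
    have h1 := mul_le_mul_of_nonneg_left (h0 u) hγ.le
    have h2 := discount_identity hγ1 κ
    rw [mul_add] at h2 ⊢
    linarith
  · obtain ⟨p, hp, h1⟩ := hstep n u
    refine ⟨p, hp, ?_⟩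
    simp only [mul_add, Finset.sum_add_distrib, ← Finset.sum_mul]
    rw [(coinSet_subset D n hp).2, one_mul]
    linarith

end Lift

end coinRFMDP

/-- The distribution under which all components agree and are fair coins. -/
def comonotoneCoins (N : ℕ) : stdSimplex ℝ (Fin N → Bool) :=
  mixture fairCoin fun b => pointMass fun _ => b

theorem marg_comonotoneCoins (N : ℕ) (i : Fin N) : marg (comonotoneCoins N) i = fairCoin.1 := by
  rw [comonotoneCoins, marg_mixture]
  simp only [marg_pointMass]
  exact sum_smul_pointMass fairCoin.1

theorem sum_comonotoneCoins (N : ℕ) (c : (Fin N → Bool) → ℝ) :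
    ∑ s, comonotoneCoins N s * c s = (c (fun _ => true) + c fun _ => false) / 2 := by
  rw [comonotoneCoins, sum_mixture_mul]
  simp only [sum_pointMass_mul, Fintype.sum_bool]
  change (1 / 2 : ℝ) * _ + (1 / 2 : ℝ) * _ = _
  ring

/-! ### Strictness of the inequalities -/

/-- The reward `[s₀] + α [s₀ ≠ s₁] + β [s₀ ≠ s₂]`. -/
def mismatchReward (α β : ℝ) (s : Fin 3 → Bool) : ℝ :=
  (if s 0 then 1 else 0) + α * (if s 0 = s 1 then 0 else 1) + β * (if s 0 = s 2 then 0 else 1)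

section Mismatch

variable {α β γ : ℝ} {hγ : 0 < γ} {hγ1 : γ < 1}
  {π : (Fin 3 → Bool) → (Finset.univ : Finset (Fin 1 → Bool))}

theorem mismatchReward_false : mismatchReward α β (fun _ => false) = 0 := by
  simp [mismatchReward]

/-- Comonotone coins avoid every mismatch, leaving only the first summand, whose expectation 1/2 is
dictated by the marginal of component 0. -/
theorem mismatch_NF (hα : 0 ≤ α) (hβ : 0 ≤ β) :
    (coinRFMDP {0, 1} (mismatchReward α β) γ hγ hγ1).NF π = γ * (1 - γ)⁻¹ * (1 / 2) := by
  rw [← zero_add (γ * (1 - γ)⁻¹ * (1 / 2)), ← mismatchReward_false (α := α) (β := β)]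
  refine le_antisymm (coinRFMDP.NF_le (comonotoneCoins 3) (fun i => ?_) ?_)
    (coinRFMDP.le_NF fun ρ hρ => ?_)
  · rw [marg_comonotoneCoins]
    exact fairCoin_mem_coinSet _ i
  · rw [sum_comonotoneCoins]
    simp [mismatchReward]
  · have h1 := sum_mul_comp_eq_sum_marg ρ 0 fun b : Bool => if b then 1 else 0
    rw [eq_fairCoin_of_mem (by simp) (hρ 0)] at h1
    simp only [Fintype.sum_bool] at h1
    norm_num at h1
    rw [← h1]
    refine Finset.sum_le_sum fun s _ => ?_
    have h0 : 0 ≤ ρ s := ρ.2.1 s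
    have h2 : (if s 0 = true then (1 : ℝ) else 0) ≤ mismatchReward α β s := by
      unfold mismatchReward
      have h3 : 0 ≤ α * (if s 0 = s 1 then 0 else 1) := by positivity
      have h4 : 0 ≤ β * (if s 0 = s 2 then 0 else 1) := by positivity
      linarith
    have h5 := mul_le_mul_of_nonneg_left h2 h0
    simpa using h5

/-- An independent component, whatever its law, differs from the fair coin `s 0` with probability
1/2. -/
theorem mismatch_F :
    (coinRFMDP {0, 1} (mismatchReward α β) γ hγ hγ1).F π =
      γ * (1 - γ)⁻¹ * ((1 + α + β) / 2) := by
  rw [← zero_add (γ * (1 - γ)⁻¹ * ((1 + α + β) / 2)),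
    ← mismatchReward_false (α := α) (β := β)]
  refine coinRFMDP.F_eq fun pm hpm => ?_
  have p0 := eq_fairCoin_of_mem (by simp) (hpm 0)
  have p1 := eq_fairCoin_of_mem (by simp) (hpm 1)
  have p2 : pm 2 true + pm 2 false = 1 := by
    simpa [Fintype.sum_bool] using (coinSet_subset _ _ (hpm 2)).2
  -- Conditional expected reward given the components below n; `pm 2 (!u 0)` is the probability that
  -- component 2 will mismatch.
  let H : ℕ → (Fin 3 → Bool) → ℝ
    | 0, _ => (1 + α + β) / 2
    | 1, u => (if u 0 then 1 else 0) + α / 2 + β * pm 2 (!u 0)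
    | 2, u => (if u 0 then 1 else 0) + α * (if u 0 = u 1 then 0 else 1) + β * pm 2 (!u 0)
    | _, u => mismatchReward α β u
  refine sum_prod_eq_of_backward pm _ (fun i => (coinSet_subset _ _ (hpm i)).2) H
    (fun _ => rfl) (fun n u => ?_) fun _ => false
  rw [Fintype.sum_bool]
  match n with
  | 0 =>
    simp [H, p0]
    linear_combination (-β / 2) * p2
  | 1 =>
    rcases hu : u 0 <;> simp [H, p1, hu] <;> ring
  | 2 =>
    rcases hu : u 0 <;> rcases hv : u 1 <;> simp [H, mismatchReward, hu, hv]
    · ring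
    · linear_combination -α * p2
    · linear_combination -(1 + α) * p2
    · linear_combination -p2

/-- Component 2 is free and drawn after component 0, so nature copies and the β term vanishes;
component 1 is a coin that cannot react, so α/2 remains. -/
theorem mismatch_L (hβ : 0 ≤ β) {s₀ : Fin 3 → Bool}
    {a₀ : (Finset.univ : Finset (Fin 1 → Bool))}
    {πl : LiftState (fun _ : Fin 3 => Bool) (Finset.univ : Finset (Fin 1 → Bool)) →
      (Finset.univ : Finset (Fin 1 → Bool))} (hπl : πl ∈ liftedPolicies s₀ a₀ π) :
    (coinRFMDP {0, 1} (mismatchReward α β) γ hγ hγ1).L s₀ a₀ πl =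
      γ * (1 - γ)⁻¹ * ((1 + α) / 2) := by
  rw [← zero_add (γ * (1 - γ)⁻¹ * ((1 + α) / 2)), ← mismatchReward_false (α := α) (β := β)]
  let H : ℕ → (Fin 3 → Bool) → ℝ
    | 0, _ => (1 + α) / 2
    | 1, u => (if u 0 then 1 else 0) + α / 2
    | 2, u => (if u 0 then 1 else 0) + α * (if u 0 = u 1 then 0 else 1)
    | _, u => mismatchReward α β u
  have hH0 : ∀ u, H 0 u = ∑ σ, (1 / 2) * H 1 (Function.update u 0 σ) := fun u => by
    simp [H]
    ring
  have hH1 : ∀ u, H 1 u = ∑ σ, (1 / 2) * H 2 (Function.update u 1 σ) := fun u => by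
    rw [Fintype.sum_bool]
    rcases hu : u 0 <;> simp [H, hu] <;> ring
  refine le_antisymm (coinRFMDP.L_le hπl H (fun _ => le_rfl) (fun _ => le_rfl) fun n u => ?_)
    (coinRFMDP.le_L hπl H (fun _ => le_rfl) (fun _ => le_rfl) fun n p hp u => ?_)
  · match n with
    | 0 => exact ⟨_, fairCoin_mem_coinSet _ _, (hH0 u).ge⟩
    | 1 => exact ⟨_, fairCoin_mem_coinSet _ _, (hH1 u).ge⟩
    | 2 =>
      -- Nature copies component 0.
      refine ⟨_, mem_coinSet_of_notMem (by decide) (pointMass (u 0)), ?_⟩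
      refine (sum_pointMass_mul (u 0) fun σ => H 3 (Function.update u 2 σ)).trans_le ?_
      simp [H, mismatchReward]
  · match n with
    | 0 =>
      rw [eq_fairCoin_of_mem (by simp) hp]
      exact (hH0 u).le
    | 1 =>
      rw [eq_fairCoin_of_mem (by simp) hp]
      exact (hH1 u).le
    | 2 =>
      have hp' := coinSet_subset _ _ hp
      refine (simplex_sum_const ⟨p, hp'⟩ (H 2 u)).ge.trans
        (simplex_sum_le (p := ⟨p, hp'⟩) fun σ _ => ?_)
      have h4 : 0 ≤ β * (if u 0 = σ then 0 else 1) := by positivity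
      simpa [H, mismatchReward] using h4

end Mismatch

/-! ### Optimal values of the instances with state-independent ambiguity -/

instance nonempty_univ_bool : Nonempty (Finset.univ : Finset (Fin 1 → Bool)) :=
  ⟨⟨fun _ => false, Finset.mem_univ _⟩⟩

namespace coinRFMDP

variable {N : ℕ} {D : Finset (Fin N)} {c : (Fin N → Bool) → ℝ} {γ : ℝ} {hγ : 0 < γ} {hγ1 : γ < 1}

theorem NFopt_eq {v : ℝ} (h : ∀ π, (coinRFMDP D c γ hγ hγ1).NF π = v) :
    (coinRFMDP D c γ hγ hγ1).NFopt = v := by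
  simp only [RFMDP.NFopt, h, ciSup_const]

theorem Fopt_eq {v : ℝ} (h : ∀ π, (coinRFMDP D c γ hγ hγ1).F π = v) :
    (coinRFMDP D c γ hγ hγ1).Fopt = v := by
  simp only [RFMDP.Fopt, h, ciSup_const]

/-- Every lifted policy belongs to `liftedPolicies` of its own restriction to the cycle starts, so
bounds there cover all lifted policies. -/
theorem Lopt_eq [NeZero N] {s₀ a₀} {v : ℝ} (h : ∀ π, ∀ πl ∈ liftedPolicies s₀ a₀ π,
    (coinRFMDP D c γ hγ hγ1).L s₀ a₀ πl = v) : (coinRFMDP D c γ hγ hγ1).Lopt s₀ a₀ = v := by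
  have h' : ∀ πl, (coinRFMDP D c γ hγ hγ1).L s₀ a₀ πl = v := fun πl =>
    h (fun u => πl (LiftState.mk u s₀ a₀ 0)) πl fun _ => rfl
  simp only [RFMDP.Lopt, h', ciSup_const]

theorem zeroOneRewards (h : ∀ s, c s = 0 ∨ c s = 1) :
    (coinRFMDP D c γ hγ hγ1).ZeroOneRewards := fun s _ => h s

theorem NF_nonneg (h0 : c (fun _ => false) = 0) (h : ∀ s, c s = 0 ∨ c s = 1) (π) :
    0 ≤ (coinRFMDP D c γ hγ hγ1).NF π := by
  have hc : ∀ s, 0 ≤ c s := fun s => by rcases h s with e | e <;> rw [e]; exact zero_le_one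
  have := le_NF (D := D) (c := c) (hγ := hγ) (hγ1 := hγ1) (π := π) (κ := 0)
    fun ρ _ => Finset.sum_nonneg fun s _ => mul_nonneg (ρ.2.1 s) (hc s)
  rwa [h0, mul_zero, add_zero] at this

end coinRFMDP

/-! ### An instance whose lift is as conservative as the non-factored model -/

section Pairs

variable {N : ℕ}

/-- The first partner of the `i`-th pair. -/
def pairLow (i : Fin (N / 2)) : Fin N := ⟨i, by omega⟩

/-- The second partner of the `i`-th pair. -/
def pairHigh (i : Fin (N / 2)) : Fin N := ⟨i + N / 2, by omega⟩

/-- The reward is `0` if both partners agree in all pairs and `1` otherwise. -/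
def pairReward (s : Fin N → Bool) : ℝ :=
  if ∀ i : Fin (N / 2), s (pairLow i) = s (pairHigh i) then 0 else 1

/-- The first partners of all pairs. -/
def lowHalf (N : ℕ) : Finset (Fin N) := Finset.univ.filter fun i => i.val < N / 2

theorem pairReward_eq_zero_or_one (s : Fin N → Bool) : pairReward s = 0 ∨ pairReward s = 1 := by
  unfold pairReward
  split_ifs <;> simp

theorem pairReward_false : pairReward (fun _ : Fin N => false) = 0 := by
  simp [pairReward]

/-- Flip the first partners of the pairs selected by `t`. -/
def flipLow (t : Fin (N / 2) → Bool) (s : Fin N → Bool) : Fin N → Bool :=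
  fun i => if h : i.val < N / 2 then xor (s i) (t ⟨i, h⟩) else s i

theorem flipLow_involutive (t : Fin (N / 2) → Bool) : Function.Involutive (flipLow (N := N) t) := by
  intro s
  funext i
  by_cases h : i.val < N / 2 <;> simp [flipLow, h]

/-- Exactly one flip pattern makes all pairs agree. -/
theorem flipLow_agree_iff (t : Fin (N / 2) → Bool) (s : Fin N → Bool) :
    (∀ i, flipLow t s (pairLow i) = flipLow t s (pairHigh i)) ↔
      t = fun i => xor (s (pairLow i)) (s (pairHigh i)) := by
  rw [funext_iff]
  refine forall_congr' fun i => ?_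
  have h1 : flipLow t s (pairLow i) = xor (s (pairLow i)) (t i) := by
    simp [flipLow, pairLow]
  have h2 : flipLow t s (pairHigh i) = s (pairHigh i) := by
    simp [flipLow, pairHigh]
  rw [h1, h2]
  cases s (pairLow i) <;> cases s (pairHigh i) <;> cases t i <;> simp

/-- Flipping fair coins preserves the product weight, so each of the 2^(N/2) flip patterns is
equally likely to be the one producing agreement. The laws of the free components play no role. -/
theorem sum_prod_pairReward {pm : Fin N → Bool → ℝ} (hpm : ∀ i, pm i ∈ coinSet (lowHalf N) i) :
    ∑ s : Fin N → Bool, (∏ i, pm i (s i)) * pairReward s = 1 - ((2 : ℝ) ^ (N / 2))⁻¹ := by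
  have hone : ∑ s : Fin N → Bool, ∏ i, pm i (s i) = 1 := by
    rw [← Fintype.prod_sum]
    exact Finset.prod_eq_one fun i _ => (coinSet_subset _ _ (hpm i)).2
  have hW : ∀ t s, ∏ i, pm i (flipLow t s i) = ∏ i, pm i (s i) := fun t s => by
    refine Finset.prod_congr rfl fun i _ => ?_
    by_cases h : i.val < N / 2
    · rw [eq_fairCoin_of_mem (by simpa [lowHalf] using h) (hpm i)]
    · simp [flipLow, h]
  let m : (Fin N → Bool) → ℝ := fun s =>
    if ∀ i : Fin (N / 2), s (pairLow i) = s (pairHigh i) then 1 else 0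
  have hflip : ∀ t, ∑ s : Fin N → Bool, (∏ i, pm i (s i)) * m (flipLow t s) =
      ∑ s : Fin N → Bool, (∏ i, pm i (s i)) * m s := fun t => by
    rw [← Equiv.sum_comp (flipLow_involutive t).toPerm fun s => (∏ i, pm i (s i)) * m s]
    exact Finset.sum_congr rfl fun s _ => by rw [Function.Involutive.coe_toPerm, hW]
  have hm : ∀ s, ∑ t, m (flipLow t s) = 1 := fun s => by
    simp only [m, flipLow_agree_iff]
    simp
  have htot : (2 : ℝ) ^ (N / 2) * ∑ s : Fin N → Bool, (∏ i, pm i (s i)) * m s = 1 := by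
    have h1 : ∑ t : Fin (N / 2) → Bool, ∑ s : Fin N → Bool, (∏ i, pm i (s i)) * m (flipLow t s) =
        (2 : ℝ) ^ (N / 2) * ∑ s : Fin N → Bool, (∏ i, pm i (s i)) * m s := by
      simp [hflip]
    rw [← h1, Finset.sum_comm]
    simp only [← Finset.mul_sum, hm, mul_one, hone]
  have hc : ∀ s : Fin N → Bool, pairReward s = 1 - m s := fun s => by
    simp only [pairReward, m]
    split_ifs <;> norm_num
  simp only [hc, mul_sub, mul_one, Finset.sum_sub_distrib, hone]
  rw [eq_inv_of_mul_eq_one_right htot]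

/-- First partners are coins drawn before the free second partners, so nature can copy each coin
into its partner. `H` is 0 as long as all completed pairs agree. -/
theorem pair_L_le_zero [NeZero N] {γ : ℝ} {hγ : 0 < γ} {hγ1 : γ < 1} {π s₀ a₀ πl}
    (hπl : πl ∈ liftedPolicies s₀ a₀ π) :
    (coinRFMDP (lowHalf N) pairReward γ hγ hγ1).L s₀ a₀ πl ≤ 0 := by
  let H : ℕ → (Fin N → Bool) → ℝ := fun n u =>
    if ∀ i : Fin (N / 2), i.val + N / 2 < n → u (pairLow i) = u (pairHigh i) then 0 else 1
  have h := coinRFMDP.L_le (D := lowHalf N) (c := pairReward) (hγ := hγ) (hγ1 := hγ1) (κ := 0)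
    hπl H (fun u => by simp [H]) (fun u => ?_) fun n u => ?_
  · rwa [pairReward_false, mul_zero, add_zero] at h
  · have : ∀ i : Fin (N / 2), i.val + N / 2 < N := fun i => by omega
    simp [H, pairReward, this]
  · by_cases hn : n.val < N / 2
    · refine ⟨_, fairCoin_mem_coinSet _ n, ?_⟩
      have h1 : ∀ v, H (n + 1) v = 0 := fun v => if_pos fun i hi => by omega
      have h2 : H n u = 0 := if_pos fun i hi => by omega
      simp [h1, h2]
    · let τ : Bool := u ⟨n - N / 2, by omega⟩
      refine ⟨_, mem_coinSet_of_notMem (by simpa [lowHalf] using hn) (pointMass τ), ?_⟩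
      refine (sum_pointMass_mul τ fun σ => H (n + 1) (Function.update u n σ)).trans_le ?_
      have himp : (∀ i : Fin (N / 2), i.val + N / 2 < n → u (pairLow i) = u (pairHigh i)) →
          ∀ i : Fin (N / 2), i.val + N / 2 < n.val + 1 →
            Function.update u n τ (pairLow i) = Function.update u n τ (pairHigh i) := by
        intro hu i hi
        have hlow : pairLow i ≠ n := fun e => hn (by rw [← e]; exact i.isLt)
        rw [Function.update_of_ne hlow]
        rcases Nat.lt_succ_iff_lt_or_eq.1 hi with hlt | heq
        · have hhigh : pairHigh i ≠ n := fun e => by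
            rw [← e] at hlt
            exact lt_irrefl _ hlt
          rw [Function.update_of_ne hhigh]
          exact hu i hlt
        · have hhigh : pairHigh i = n := Fin.ext heq
          rw [hhigh, Function.update_self]
          refine congrArg u (Fin.ext ?_)
          change i.val = n.val - N / 2
          omega
      simp only [H]
      split_ifs with h1 h2 h2
      · exact le_rfl
      · exact zero_le_one
      · exact absurd (himp h2) h1
      · exact le_rfl

theorem exists_NF_eq_L_lt_F (N : ℕ) [NeZero N] (γ : ℝ) (hγ : 0 < γ) (hγ1 : γ < 1) :
    ∃ (k F : ℕ) (A : Finset (Fin k → Bool)) (R : BinaryRFMDP N A F),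
      A.Nonempty ∧ R.γ = γ ∧ R.ZeroOneRewards ∧ R.NFopt = 0 ∧ (∀ s₀ a₀, R.Lopt s₀ a₀ = 0) ∧
        R.Fopt = γ * (1 - γ)⁻¹ * (1 - ((2 : ℝ) ^ (N / 2))⁻¹) := by
  have hnonneg := coinRFMDP.NF_nonneg (D := lowHalf N) (hγ := hγ) (hγ1 := hγ1)
    pairReward_false pairReward_eq_zero_or_one
  have hL : ∀ s₀ a₀ π, ∀ πl ∈ liftedPolicies s₀ a₀ π,
      (coinRFMDP (lowHalf N) pairReward γ hγ hγ1).L s₀ a₀ πl = 0 := fun s₀ a₀ π πl hπl =>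
    le_antisymm (pair_L_le_zero hπl) ((hnonneg π).trans (RFMDP.NF_le_L _ hπl))
  refine ⟨1, N, Finset.univ, coinRFMDP (lowHalf N) pairReward γ hγ hγ1, Finset.univ_nonempty, rfl,
    coinRFMDP.zeroOneRewards pairReward_eq_zero_or_one, coinRFMDP.NFopt_eq fun π => ?_,
    fun s₀ a₀ => coinRFMDP.Lopt_eq (hL s₀ a₀), coinRFMDP.Fopt_eq fun π => ?_⟩
  · refine le_antisymm ?_ (hnonneg π)
    let s₀ : Fin N → Bool := fun _ => false
    let a₀ := π s₀
    have hπl : (fun x => π (LiftState.u x)) ∈ liftedPolicies s₀ a₀ π := fun _ => rfl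
    exact (RFMDP.NF_le_L _ hπl).trans (pair_L_le_zero hπl)
  · rw [coinRFMDP.F_eq fun pm hpm => sum_prod_pairReward hpm, pairReward_false, zero_add]

end Pairs

/-! ### An instance whose lift is as tight as the factored model -/

section Consensus

variable {N : ℕ} [NeZero N]

/-- The reward is `0` if all components agree and `1` otherwise. -/
def consensusReward (s : Fin N → Bool) : ℝ := if ∀ i, s i = s 0 then 0 else 1

theorem consensusReward_eq_zero_or_one (s : Fin N → Bool) :
    consensusReward s = 0 ∨ consensusReward s = 1 := by
  unfold consensusReward
  split_ifs <;> simp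

theorem consensusReward_const (b : Bool) : consensusReward (fun _ : Fin N => b) = 0 := by
  simp [consensusReward]

/-- Two of the 2^N equally likely vectors are constant. -/
theorem sum_prod_consensusReward :
    ∑ s : Fin N → Bool, (∏ i, fairCoin.1 (s i)) * consensusReward s =
      1 - ((2 : ℝ) ^ (N - 1))⁻¹ := by
  have hc : ∀ s : Fin N → Bool,
      consensusReward s = 1 - ∑ b : Bool, if s = fun _ => b then 1 else 0 := fun s => by
    have h1 : ∀ b, (s = fun _ => b) ↔ b = s 0 ∧ ∀ i, s i = s 0 := fun b =>
      ⟨fun h => by subst h; simp, fun h => funext fun i => (h.2 i).trans h.1.symm⟩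
    simp only [h1, consensusReward]
    by_cases h : ∀ i, s i = s 0
    · simp [h]
    · simp [h]
  have hW : ∀ s : Fin N → Bool, ∏ i, fairCoin.1 (s i) = (1 / 2 : ℝ) ^ N := fun s => by
    simp [fairCoin]
  simp only [hW, hc, ← Finset.mul_sum, Finset.sum_sub_distrib]
  rw [Finset.sum_comm]
  obtain ⟨n, rfl⟩ := Nat.exists_eq_succ_of_ne_zero (NeZero.ne N)
  have h2 : (2 : ℝ) ^ n ≠ 0 := by positivity
  simp [pow_succ]
  field_simp

/-- All ambiguity sets are the singleton fair coin: the lift and the factored model leave nature no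
choice and draw independently, while NF may still couple the coins comonotonically. -/
theorem exists_NF_lt_L_eq_F (N : ℕ) [NeZero N] (γ : ℝ) (hγ : 0 < γ) (hγ1 : γ < 1) :
    ∃ (k F : ℕ) (A : Finset (Fin k → Bool)) (R : BinaryRFMDP N A F),
      A.Nonempty ∧ R.γ = γ ∧ R.ZeroOneRewards ∧ R.NFopt = 0 ∧
        (∀ s₀ a₀, R.Lopt s₀ a₀ = γ * (1 - γ)⁻¹ * (1 - ((2 : ℝ) ^ (N - 1))⁻¹)) ∧
        R.Fopt = γ * (1 - γ)⁻¹ * (1 - ((2 : ℝ) ^ (N - 1))⁻¹) := by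
  have hF : ∀ π, (coinRFMDP Finset.univ (consensusReward (N := N)) γ hγ hγ1).F π =
      γ * (1 - γ)⁻¹ * (1 - ((2 : ℝ) ^ (N - 1))⁻¹) := fun π => by
    rw [coinRFMDP.F_eq (κ := 1 - ((2 : ℝ) ^ (N - 1))⁻¹) fun pm hpm => ?_,
      consensusReward_const, zero_add]
    have : pm = fun _ => fairCoin.1 := funext fun i =>
      eq_fairCoin_of_mem (Finset.mem_univ i) (hpm i)
    rw [this]
    exact sum_prod_consensusReward
  refine ⟨1, N, Finset.univ, coinRFMDP Finset.univ consensusReward γ hγ hγ1,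
    Finset.univ_nonempty, rfl, coinRFMDP.zeroOneRewards consensusReward_eq_zero_or_one,
    coinRFMDP.NFopt_eq fun π => ?_, fun s₀ a₀ => coinRFMDP.Lopt_eq fun π πl hπl => ?_,
    coinRFMDP.Fopt_eq hF⟩
  · refine le_antisymm ?_ (coinRFMDP.NF_nonneg (consensusReward_const false)
      consensusReward_eq_zero_or_one π)
    refine (coinRFMDP.NF_le (κ := 0) (comonotoneCoins N) (fun i => ?_) ?_).trans_eq ?_
    · rw [marg_comonotoneCoins]
      exact fairCoin_mem_coinSet _ i
    · simp [sum_comonotoneCoins, consensusReward_const]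
    · rw [consensusReward_const, mul_zero, add_zero]
  · refine le_antisymm ((RFMDP.L_le_F _ hπl).trans_eq (hF π)) ?_
    rw [← zero_add (γ * (1 - γ)⁻¹ * (1 - ((2 : ℝ) ^ (N - 1))⁻¹)),
      ← consensusReward_const (N := N) false]
    have hq : ∑ σ, fairCoin.1 σ = 1 := fairCoin.2.2
    refine coinRFMDP.le_L hπl (tailExp (fun _ => fairCoin.1) consensusReward) (fun u => ?_)
      (fun u => (tailExp_last _ _ (fun _ => hq) u).le) fun n p hp u => ?_
    · rw [tailExp_zero, sum_prod_consensusReward]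
    · have hp' : p = fairCoin.1 := eq_fairCoin_of_mem (Finset.mem_univ n) hp
      rw [hp']
      exact (tailExp_step _ _ n hq u).le

end Consensus

/-! ### The main theorem -/

theorem mainTheorem5 :
    -- (i), the inequalities
    (∀ (N : ℕ) [NeZero N] (S : Fin N → Type) [∀ n, Fintype (S n)] (A : Type) [Fintype A]
      (Φ : Type) (R : RFMDP S A Φ) (s₀ : ∀ n, S n) (a₀ : A) (π : (∀ n, S n) → A),
      ∀ πl ∈ liftedPolicies s₀ a₀ π, R.NF π ≤ R.L s₀ a₀ πl ∧ R.L s₀ a₀ πl ≤ R.F π) ∧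
    -- (i), none of the inequalities is tight
    (∃ (N : ℕ) (_ : NeZero N) (k F : ℕ) (A : Finset (Fin k → Bool)) (R : BinaryRFMDP N A F)
      (π : (Fin N → Bool) → A),
      ∀ s₀ a₀, ∀ πl ∈ liftedPolicies s₀ a₀ π,
        R.NF π < R.L s₀ a₀ πl ∧ R.L s₀ a₀ πl < R.F π) ∧
    -- (i), only the first inequality is tight
    (∃ (N : ℕ) (_ : NeZero N) (k F : ℕ) (A : Finset (Fin k → Bool)) (R : BinaryRFMDP N A F)
      (π : (Fin N → Bool) → A),
      ∀ s₀ a₀, ∀ πl ∈ liftedPolicies s₀ a₀ π,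
        R.NF π = R.L s₀ a₀ πl ∧ R.L s₀ a₀ πl < R.F π) ∧
    -- (i), only the second inequality is tight
    (∃ (N : ℕ) (_ : NeZero N) (k F : ℕ) (A : Finset (Fin k → Bool)) (R : BinaryRFMDP N A F)
      (π : (Fin N → Bool) → A),
      ∀ s₀ a₀, ∀ πl ∈ liftedPolicies s₀ a₀ π,
        R.NF π < R.L s₀ a₀ πl ∧ R.L s₀ a₀ πl = R.F π) ∧
    -- (i), both inequalities are tight
    (∃ (N : ℕ) (_ : NeZero N) (k F : ℕ) (A : Finset (Fin k → Bool)) (R : BinaryRFMDP N A F)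
      (π : (Fin N → Bool) → A),
      ∀ s₀ a₀, ∀ πl ∈ liftedPolicies s₀ a₀ π,
        R.NF π = R.L s₀ a₀ πl ∧ R.L s₀ a₀ πl = R.F π) ∧
    -- (ii)
    (∀ (N : ℕ) [NeZero N] (γ : ℝ), 0 < γ → γ < 1 →
      ∃ (k F : ℕ) (A : Finset (Fin k → Bool)) (R : BinaryRFMDP N A F),
        A.Nonempty ∧ R.γ = γ ∧ R.ZeroOneRewards ∧ R.NFopt = 0 ∧ (∀ s₀ a₀, R.Lopt s₀ a₀ = 0) ∧
        R.Fopt = γ * (1 - γ)⁻¹ * (1 - ((2 : ℝ) ^ (N / 2))⁻¹)) ∧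
    -- (iii)
    (∀ (N : ℕ) [NeZero N] (γ : ℝ), 0 < γ → γ < 1 →
      ∃ (k F : ℕ) (A : Finset (Fin k → Bool)) (R : BinaryRFMDP N A F),
        A.Nonempty ∧ R.γ = γ ∧ R.ZeroOneRewards ∧ R.NFopt = 0 ∧
        (∀ s₀ a₀, R.Lopt s₀ a₀ = γ * (1 - γ)⁻¹ * (1 - ((2 : ℝ) ^ (N - 1))⁻¹)) ∧
        R.Fopt = γ * (1 - γ)⁻¹ * (1 - ((2 : ℝ) ^ (N - 1))⁻¹)) := by
  have hγ : (0 : ℝ) < 1 / 2 := by norm_num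
  have hγ1 : (1 / 2 : ℝ) < 1 := by norm_num
  let π : (Fin 3 → Bool) → (Finset.univ : Finset (Fin 1 → Bool)) :=
    fun _ => ⟨fun _ => false, Finset.mem_univ _⟩
  refine ⟨fun N _ S _ A _ Φ R s₀ a₀ π πl hπl => ⟨R.NF_le_L hπl, R.L_le_F hπl⟩,
    -- The one-step constants for NF, L and F are 1/2, (1+α)/2 and (1+α+β)/2, so α and β separately
    -- switch the two gaps on and off.
    ⟨3, inferInstance, 1, 3, Finset.univ, coinRFMDP {0, 1} (mismatchReward 1 1) (1 / 2) hγ hγ1, π,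
      fun s₀ a₀ πl hπl => ?_⟩,
    ⟨3, inferInstance, 1, 3, Finset.univ, coinRFMDP {0, 1} (mismatchReward 0 1) (1 / 2) hγ hγ1, π,
      fun s₀ a₀ πl hπl => ?_⟩,
    ⟨3, inferInstance, 1, 3, Finset.univ, coinRFMDP {0, 1} (mismatchReward 1 0) (1 / 2) hγ hγ1, π,
      fun s₀ a₀ πl hπl => ?_⟩,
    ⟨3, inferInstance, 1, 3, Finset.univ, coinRFMDP {0, 1} (mismatchReward 0 0) (1 / 2) hγ hγ1, π,
      fun s₀ a₀ πl hπl => ?_⟩,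
    fun N _ γ hγ hγ1 => exists_NF_eq_L_lt_F N γ hγ hγ1,
    fun N _ γ hγ hγ1 => exists_NF_lt_L_eq_F N γ hγ hγ1⟩
  all_goals
    rw [mismatch_NF (by norm_num) (by norm_num), mismatch_F, mismatch_L (by norm_num) hπl]
    norm_num

end
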